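/- Let $W(Y)=Y-e^{Y}$ on the complex $Y$-plane with its flat metric, with critical points $Y_k=2\pi i k$, $k\in\mathbb Z$. For $|\zeta|=1$ let the left Lefschetz thimble $L_k(\zeta)$ be the set of points $p\in\mathbb C$ whose backward trajectory under the gradient flow of $\mathrm{Re}(\zeta^{-1}W)$ (that is, the solution of $dY/dx=\zeta\,\overline{W'(Y)}$, $Y(0)=p$) exists for all $x\le 0$ and tends to $Y_k$ as $x\to-\infty$. Since $W''(Y_k)=-1$, the unit tangent vectors of $L_k(\zeta)$ at $Y_k$ are the two square roots of $-\zeta$. Orient the thimbles with $\mathrm{Re}\,\zeta\ne 0$ by choosing such a tangent vector $o(\zeta)$ independent of $k$ and continuous in $\zeta$ on each of the half-circles $\mathrm{Re}\,\zeta>0$ and $\mathrm{Re}\,\zeta<0$; the choice is otherwise arbitrary. At a transversal intersection point of two oriented thimbles, the orientation of the point is the sign of the basis (positive tangent of the first thimble, positive tangent of the second thimble) with respect to the standard orientation of $\mathbb C$. Let $\theta,\theta'\in(0,\frac{\pi}{2})$ and, for $k,l\in\mathbb Z$, put $$I_{k,l}(\theta,\theta')=L_k(-e^{-i\theta'})\cap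 L_l(-e^{i\theta}),\qquad J_{k,l}(\theta,\theta')=L_k(e^{-i\theta'})\cap L_l(e^{i\theta}).$$ The thimbles occurring in a non-empty intersection are $C^1$ embedded curves (regular embedded images of $\mathbb R$), they cross transversally, and: 1. $I_{k,l}(\theta,\theta')$ consists of a single point, with positive orientation, if $k\le l$, and is empty otherwise. 2. $J_{k,l}(\theta,\theta')$ consists of a single point, with negative orientation if $k=l+1$ and with positive orientation if $k=l$, and is empty otherwise. -/

import Mathlib

open Set Filter Topology

noncomputable section

namespace Thimble

/-- The superpotential `W = Y - e ^ Y` on the complex `Y`-plane. -/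
def W (Y : ℂ) : ℂ := Y - Complex.exp Y

/-- The critical points `Y_k = 2 π i k` of `W`. -/
def crit (k : ℤ) : ℂ := 2 * (Real.pi : ℂ) * Complex.I * (k : ℂ)

/-- The vector field whose flow is the gradient flow of the real function `Re (ζ⁻¹ W)` on the
`Y`-plane with its flat metric. For `‖ζ‖ = 1` it is `ζ` times the complex conjugate of `W'`. -/
def gradField (ζ : ℂ) : ℂ → ℂ :=
  gradient (fun Y : ℂ => (ζ⁻¹ * W Y).re)

/-- The left Lefschetz thimble `L_k(ζ)`: the points whose backward trajectory under the gradient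
flow of `Re (ζ⁻¹ W)` exists for all times `x ≤ 0` and converges to `Y_k` as `x → -∞`. Only
backward trajectories are asked to exist, since forward ones may blow up in finite time. -/
def L (k : ℤ) (ζ : ℂ) : Set ℂ :=
  {p | ∃ γ : ℝ → ℂ, IsIntegralCurveOn γ (fun _ => gradField ζ) (Iic 0) ∧
    γ 0 = p ∧ Tendsto γ atBot (𝓝 (crit k))}

/-- A coherent choice of orientations of all the thimbles `L_k(ζ)` with `‖ζ‖ = 1`, `Re ζ ≠ 0`:
a tangent direction `o ζ` of `L_k(ζ)` at `Y_k` that does not depend on `k` (so it is invariant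
under the deck transformations `Y ↦ Y + 2 π i`) and is continuous in the phase `ζ` on each of the
half-circles `Re ζ > 0` and `Re ζ < 0`.  As `W = W(Y_k) - (Y - Y_k)² / 2 + ⋯`, the two unit
tangent vectors of `L_k(ζ)` at `Y_k` are the square roots of `-ζ`. -/
def IsOrientation (o : ℂ → ℂ) : Prop :=
  ContinuousOn o {ζ | ‖ζ‖ = 1 ∧ ζ.re ≠ 0} ∧ ∀ ζ : ℂ, ‖ζ‖ = 1 → ζ.re ≠ 0 → o ζ ^ 2 = -ζ

/-- `γ` is a regular parametrization of the whole embedded curve `C ⊆ ℂ` which runs through the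
point `q` in the direction `v`. It orients `C` by its velocity. -/
structure IsOrientedParam (C : Set ℂ) (q v : ℂ) (γ : ℝ → ℂ) : Prop where
  contDiff : ContDiff ℝ 1 γ
  isEmbedding : IsEmbedding γ
  deriv_ne_zero : ∀ t, deriv γ t ≠ 0
  range_eq : range γ = C
  map_zero : γ 0 = q
  deriv_zero : ∃ c : ℝ, 0 < c ∧ deriv γ 0 = c • v

/-- The thimbles `L_k(ζ)` and `L_l(ζ')`, oriented by `o`, are embedded curves whose only common
point is `p`, they cross transversally there, and the orientation (local intersection number) of
`p` is `ε`: the sign of the determinant of the pair (positive tangent vector of `L_k(ζ)`,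
positive tangent vector of `L_l(ζ')`) at `p`, in this order, for the standard orientation
of `ℂ`. -/
def MeetsOnceAt (o : ℂ → ℂ) (k : ℤ) (ζ : ℂ) (l : ℤ) (ζ' : ℂ) (p : ℂ) (ε : SignType) : Prop :=
  L k ζ ∩ L l ζ' = {p} ∧
  ∃ (γ δ : ℝ → ℂ) (s t : ℝ),
    IsOrientedParam (L k ζ) (crit k) (o ζ) γ ∧ IsOrientedParam (L l ζ') (crit l) (o ζ') δ ∧
    γ s = p ∧ δ t = p ∧
    (deriv γ s).re * (deriv δ t).im - (deriv γ s).im * (deriv δ t).re ≠ 0 ∧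
    SignType.sign ((deriv γ s).re * (deriv δ t).im - (deriv γ s).im * (deriv δ t).re) = ε

end Thimble

end

noncomputable section

namespace Thimble

open ComplexConjugate

/-! ### The superpotential and its gradient field -/

/-! Along a trajectory leaving `Y_k`, the quantity `ζ⁻¹ (W - W(Y_k))` has derivative `|W'|² ≥ 0` and
tends to `0` at `-∞`, so `W` moves out on the ray `W(Y_k) + ζ ℝ≥0` (`exists_W_eq_of_trajectory`).
All critical values `-1 + 2πik` lie on the line `Re w = -1`, so for `Re ζ ≠ 0` the open ray stays in
one of the two half-planes bounded by this line. Over such a half-plane `W` is inverted on sheets,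
two of which touch the critical point `0`: over the right one, the sheets in the strips above and
below `0`; over the left one, a sheet in `Re Y < 0` and a sheet in `Re Y > 0`. The thimble is the
union of the two lifts of the ray, joined smoothly at `0` by a Morse coordinate and parametrized by
`W = -1 + ζ s²` (`exists_isThimbleParam`, `range_eq`). Translation by `2πik` gives the other
thimbles.

An intersection point lies over a common point of two rays. These have at most one common point,
found by Cramer's rule with determinant `sin (θ + θ')` (`W_eq_iff`). What remains is to see which
lifts share a sheet. Over the left half-plane the left sheet is invariant under all translations,
while the right sheets are pairwise disjoint, so any two rays that meet give exactly one point, on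
the branches `s, t < 0`. Over the right half-plane the thimble of `Y_k` occupies strips `k - 1` and
`k`; for `k > l` a strip is shared only when `k = l + 1`, with `s < 0 < t`.

Since `W` is conformal there, the sign at a point off the critical points is that of `s t sin (θ +
θ')`, hence that of `s t` (`meetsOnceAt_of_eq`). For `k = l` only the critical point remains, and
the sign comes from the square roots `o ζ'`, `o ζ` (`meetsOnceAt_self`); continuity of `o` puts
these on the same side of a fixed line (`re_mul_re_pos`). -/

lemma hasStrictDerivAt_W (Y : ℂ) : HasStrictDerivAt W (1 - Complex.exp Y) Y :=
  (hasStrictDerivAt_id Y).sub (Complex.hasStrictDerivAt_exp Y)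

lemma hasDerivAt_W (Y : ℂ) : HasDerivAt W (1 - Complex.exp Y) Y :=
  (hasStrictDerivAt_W Y).hasDerivAt

lemma continuous_W : Continuous W := continuous_id.sub Complex.continuous_exp

lemma W_re (Y : ℂ) : (W Y).re = Y.re - Real.exp Y.re * Real.cos Y.im := by
  simp [W, Complex.exp_re]

lemma W_im (Y : ℂ) : (W Y).im = Y.im - Real.exp Y.re * Real.sin Y.im := by
  simp [W, Complex.exp_im]

@[simp] lemma W_zero : W 0 = -1 := by simp [W]

@[simp] lemma crit_re (k : ℤ) : (crit k).re = 0 := by simp [crit]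

@[simp] lemma crit_im (k : ℤ) : (crit k).im = 2 * Real.pi * k := by simp [crit]

@[simp] lemma crit_zero : crit 0 = 0 := by simp [crit]

lemma exp_add_crit (Y : ℂ) (k : ℤ) : Complex.exp (Y + crit k) = Complex.exp Y := by
  have h : Complex.exp (crit k) = 1 :=
    Complex.exp_eq_one_iff.2 ⟨k, by simp only [crit]; ring⟩
  rw [Complex.exp_add, h, mul_one]

lemma W_add_crit (Y : ℂ) (k : ℤ) : W (Y + crit k) = W Y + crit k := by
  simp only [W, exp_add_crit]; ring

lemma inv_eq_conj_of_norm_eq_one {ζ : ℂ} (hζ : ‖ζ‖ = 1) : ζ⁻¹ = conj ζ := by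
  rw [Complex.inv_def, Complex.normSq_eq_norm_sq, hζ]; simp

lemma mul_conj_of_norm_eq_one {ζ : ℂ} (hζ : ‖ζ‖ = 1) : ζ * conj ζ = 1 := by
  rw [Complex.mul_conj, Complex.normSq_eq_norm_sq, hζ]; simp

lemma gradField_apply {ζ : ℂ} (hζ : ‖ζ‖ = 1) (Y : ℂ) :
    gradField ζ Y = ζ * conj (1 - Complex.exp Y) := by
  apply HasGradientAt.gradient
  rw [hasGradientAt_iff_hasFDerivAt]
  have h := (Complex.reCLM.hasFDerivAt (x := ζ⁻¹ * W Y)).comp Y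
    (((hasDerivAt_W Y).const_mul ζ⁻¹).hasFDerivAt.restrictScalars ℝ)
  refine h.congr_fderiv ?_
  ext
  all_goals simp [inv_eq_conj_of_norm_eq_one hζ, Complex.inner]

/-- The gradient field is `2πi`-periodic, so trajectories can be translated. This reduces the study
of thimbles to the critical point `0`. -/
lemma L_eq_preimage {ζ : ℂ} (hζ : ‖ζ‖ = 1) (k : ℤ) : L k ζ = {p | p - crit k ∈ L 0 ζ} := by
  have key : ∀ (a b : ℤ) (p q : ℂ), p = q + crit (a - b) → q ∈ L b ζ → p ∈ L a ζ := by
    rintro a b p q rfl ⟨γ, h1, h2, h3⟩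
    refine ⟨fun x => γ x + crit (a - b), fun t ht => ?_, by simp [h2], ?_⟩
    · have := (h1 t ht).add_const (crit (a - b))
      simpa only [gradField_apply hζ, exp_add_crit] using this
    · have := h3.add_const (crit (a - b))
      convert this using 2
      simp [crit]; ring
  ext p
  refine ⟨key 0 k _ _ ?_, key k 0 _ _ ?_⟩ <;> simp [crit, sub_eq_add_neg]

/-! ### Injectivity and surjectivity of holomorphic maps -/

/-- The Noshiro–Warschawski criterion: along the segment from `a` to `b`, `Re (c conj(b - a) f)` has
derivative `|b - a|² Re (c f') > 0`, which Rolle's theorem forbids if `f a = f b`. -/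
lemma injOn_of_re_mul_deriv_pos {f f' : ℂ → ℂ} {s : Set ℂ} (hs : Convex ℝ s)
    (hf : ∀ z ∈ s, HasDerivAt f (f' z) z) (c : ℂ) (hpos : ∀ z ∈ s, 0 < (c * f' z).re) :
    InjOn f s := by
  intro a ha b hb hab
  by_contra hne
  have hmem : ∀ t ∈ Icc (0 : ℝ) 1, a + t * (b - a) ∈ s := fun t ht => by
    have := hs.add_smul_sub_mem ha hb ht
    simpa using this
  have hd : ∀ t ∈ Icc (0 : ℝ) 1,
      HasDerivAt (fun t : ℝ => (c * conj (b - a) * f (a + t * (b - a))).re)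
        (c * conj (b - a) * (f' (a + t * (b - a)) * (b - a))).re t := by
    intro t ht
    have h1 : HasDerivAt (fun t : ℝ => a + (t : ℂ) * (b - a)) (b - a) t := by
      simpa using ((Complex.ofRealCLM.hasDerivAt (x := t)).mul_const (b - a)).const_add a
    have h2 := ((hf _ (hmem t ht)).comp t h1).const_mul (c * conj (b - a))
    exact Complex.reCLM.hasFDerivAt.comp_hasDerivAt t h2
  obtain ⟨t, ht, h0⟩ := exists_hasDerivAt_eq_zero (zero_lt_one' ℝ)
    (fun t ht => (hd t ht).continuousAt.continuousWithinAt) (by simp [hab])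
    (fun t ht => hd t (Ioo_subset_Icc_self ht))
  have hp := hpos _ (hmem t (Ioo_subset_Icc_self ht))
  have : c * conj (b - a) * (f' (a + t * (b - a)) * (b - a))
      = c * f' (a + t * (b - a)) * (Complex.normSq (b - a) : ℂ) := by
    rw [← Complex.mul_conj]; ring
  rw [this, Complex.re_mul_ofReal] at h0
  have h3 : 0 < Complex.normSq (b - a) := Complex.normSq_pos.2 (sub_ne_zero.2 (Ne.symm hne))
  exact (mul_pos hp h3).ne' h0

/-- The image is open by the inverse function theorem and relatively closed in `T` by compactness:
preimages of a convergent sequence are bounded by `hb`, and `hcl` keeps their limit inside `U`.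
Connectedness of `T` finishes. -/
lemma surjOn_of_isBounded {f f' : ℂ → ℂ} {U T : Set ℂ} (hU : IsOpen U) (hf : Continuous f)
    (hd : ∀ z ∈ U, HasStrictDerivAt f (f' z) z) (hd' : ∀ z ∈ U, f' z ≠ 0)
    (hT : IsPreconnected T) (hmaps : MapsTo f U T) (hne : U.Nonempty)
    (hb : ∀ R : ℝ, Bornology.IsBounded {z ∈ U | ‖f z‖ ≤ R})
    (hcl : ∀ z ∈ closure U, f z ∈ T → z ∈ U) : SurjOn f U T := by
  refine hT.subset_of_closure_inter_subset ?_ ?_ ?_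
  · rw [isOpen_iff_mem_nhds]
    rintro _ ⟨z, hz, rfl⟩
    rw [← (hd z hz).map_nhds_eq (hd' z hz)]
    exact image_mem_map (hU.mem_nhds hz)
  · obtain ⟨z, hz⟩ := hne
    exact ⟨f z, hmaps hz, z, hz, rfl⟩
  · rintro w ⟨hw, hwT⟩
    obtain ⟨u, hu, hlim⟩ := mem_closure_iff_seq_limit.1 hw
    choose y hyU hy using hu
    obtain ⟨R, hR⟩ := (Metric.isBounded_range_of_tendsto u hlim).exists_norm_le
    obtain ⟨z, hz, φ, hφ, hzlim⟩ := tendsto_subseq_of_bounded (hb R)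
      (fun n => ⟨hyU n, by rw [hy]; exact hR _ ⟨n, rfl⟩⟩ : ∀ n, y n ∈ {z ∈ U | ‖f z‖ ≤ R})
    have hfz : f z = w := by
      refine tendsto_nhds_unique ((hf.tendsto z).comp hzlim) ?_
      have := hlim.comp hφ.tendsto_atTop
      convert this using 1
      ext n; simp [hy]
    exact ⟨z, hcl z (closure_mono (fun _ h => h.1) hz) (hfz ▸ hwT), hfz⟩

/-! ### Sheets of the superpotential -/

/-- The half-plane to the right (`η = 1`) or to the left (`η = -1`) of the vertical line through
the critical values. -/
def halfPlane (η : ℝ) : Set ℂ := {w | 0 < η * (w.re + 1)}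

lemma isOpen_halfPlane (η : ℝ) : IsOpen (halfPlane η) :=
  isOpen_lt continuous_const (by fun_prop)

lemma isPreconnected_halfPlane (η : ℝ) : IsPreconnected (halfPlane η) := by
  have : halfPlane η = {w : ℂ | -η < η * w.re} := by
    ext w; simp only [halfPlane, mem_ofPred_eq]; constructor <;> intro h <;> linarith
  rw [this]
  refine (convex_halfSpace_gt (f := fun w : ℂ => η * w.re) ⟨fun x y => ?_, fun c x => ?_⟩ _).isPreconnected
  · simp; ring
  · simp; ring

/-- `U` is a domain on one side of the line `i μ ℝ` which `W` maps bijectively onto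
`halfPlane η`. -/
structure IsSheet (η : ℝ) (μ : ℂ) (U : Set ℂ) : Prop where
  isOpen : IsOpen U
  re_pos : ∀ Y ∈ U, 0 < (conj μ * Y).re
  exp_ne_one : ∀ Y ∈ U, Complex.exp Y ≠ 1
  bijOn : BijOn W U (halfPlane η)

lemma isSheet_of_domain {η : ℝ} {μ : ℂ} {D : Set ℂ} (hD : IsOpen D)
    (hre : ∀ Y ∈ D, 0 < (conj μ * Y).re) (hexp : ∀ Y ∈ D, Complex.exp Y ≠ 1)
    (hinj : InjOn W D) (hne : (D ∩ W ⁻¹' halfPlane η).Nonempty)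
    (hb : ∀ R : ℝ, Bornology.IsBounded {z ∈ D | ‖W z‖ ≤ R})
    (hcl : ∀ z ∈ closure D, W z ∈ halfPlane η → z ∈ D) :
    IsSheet η μ (D ∩ W ⁻¹' halfPlane η) where
  isOpen := hD.inter ((isOpen_halfPlane η).preimage continuous_W)
  re_pos Y hY := hre Y hY.1
  exp_ne_one Y hY := hexp Y hY.1
  bijOn := by
    refine ⟨fun _ h => h.2, hinj.mono inter_subset_left, ?_⟩
    refine surjOn_of_isBounded (hD.inter ((isOpen_halfPlane η).preimage continuous_W))
      continuous_W (fun z _ => hasStrictDerivAt_W z)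
      (fun z hz => sub_ne_zero.2 (hexp z hz.1).symm) (isPreconnected_halfPlane η)
      (fun _ h => h.2) hne (fun R => (hb R).subset fun z hz => ⟨hz.1.1, hz.2⟩)
      (fun z hz hzT => ⟨hcl z (closure_mono inter_subset_left hz) hzT, hzT⟩)

/-- Properness of `W` on horizontal strips: for `Re Y ≤ 0` the exponential is bounded, and for `Re Y
≥ 0` it dominates `Y`. The constant `7` leaves room for `2π`. -/
lemma norm_le_of_norm_W_le {Y : ℂ} {R : ℝ} (hW : ‖W Y‖ ≤ R) (him : |Y.im| ≤ 7) :
    ‖Y‖ ≤ 2 * R + 30 := by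
  have h0 : 0 ≤ R := (norm_nonneg _).trans hW
  have h1 : |(W Y).re| ≤ R := (Complex.abs_re_le_norm _).trans hW
  have h2 := Complex.norm_le_abs_re_add_abs_im Y
  have h4 : ‖Complex.exp Y‖ = Real.exp Y.re := Complex.norm_exp Y
  have h5 : ‖Y‖ - ‖Complex.exp Y‖ ≤ ‖W Y‖ := norm_sub_norm_le _ _
  have h6 : ‖Complex.exp Y‖ - ‖Y‖ ≤ ‖W Y‖ := by
    rw [W, norm_sub_rev]; exact norm_sub_norm_le _ _
  rcases le_total Y.re 0 with h | h
  · have : Real.exp Y.re ≤ 1 := Real.exp_le_one_iff.2 h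
    linarith
  · have h7 := Real.quadratic_le_exp_of_nonneg h
    rw [abs_of_nonneg h] at h2
    have h8 : Y.re ^ 2 ≤ 2 * (R + 6) := by linarith
    have h9 : Y.re ≤ 2 * R + 23 := by nlinarith
    linarith

lemma isBounded_of_abs_im_le {D : Set ℂ} (hD : ∀ Y ∈ D, |Y.im| ≤ 7) (R : ℝ) :
    Bornology.IsBounded {z ∈ D | ‖W z‖ ≤ R} :=
  isBounded_iff_forall_norm_le.2 ⟨2 * R + 30, fun z hz => norm_le_of_norm_W_le hz.2 (hD z hz.1)⟩

/-- The left half-plane. -/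
def leftDomain : Set ℂ := {Y | Y.re < 0}

/-- The image of the half-plane `1 < Re z` under the principal logarithm. -/
def rightDomain : Set ℂ := {Y | |Y.im| < Real.pi / 2 ∧ 1 < (Complex.exp Y).re}

/-- The horizontal strip between the critical points `Y_m` and `Y_{m+1}`. -/
def strip (m : ℤ) : Set ℂ := {Y | Y.im ∈ Ioo (2 * Real.pi * m) (2 * Real.pi * (m + 1))}

/-- The sheet over the left half-plane which is contained in the left half-plane. -/
def leftSheet : Set ℂ := leftDomain ∩ W ⁻¹' halfPlane (-1)

/-- The sheet over the left half-plane to the right of the critical point `0`. -/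
def rightSheet : Set ℂ := rightDomain ∩ W ⁻¹' halfPlane (-1)

/-- The sheet over the right half-plane contained in a horizontal strip. -/
def stripSheet (m : ℤ) : Set ℂ := strip m ∩ W ⁻¹' halfPlane 1

/-- Here `|e^Y| < 1`, so `Re W' > 0`. On the boundary `Re Y = 0` one has `Re W = -cos (Im Y) ≥ -1`,
outside the open left half-plane. -/
lemma isSheet_leftSheet : IsSheet (-1) (-1) leftSheet := by
  have hlt : ∀ Y ∈ leftDomain, ‖Complex.exp Y‖ < 1 := fun Y hY => by
    rw [Complex.norm_exp]; exact Real.exp_lt_one_iff.2 hY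
  refine isSheet_of_domain (isOpen_lt Complex.continuous_re continuous_const) ?_ ?_ ?_ ?_ ?_ ?_
  · intro Y (hY : Y.re < 0)
    simpa using hY
  · intro Y hY h
    have := hlt Y hY
    simp [h] at this
  · refine injOn_of_re_mul_deriv_pos (convex_halfSpace_re_lt 0) (fun z _ => hasDerivAt_W z) 1 ?_
    intro z hz
    have := (Complex.re_le_norm _).trans_lt (hlt z hz)
    simp only [one_mul, Complex.sub_re, Complex.one_re]
    linarith
  · refine ⟨-5, ?_, ?_⟩
    · simp [leftDomain]
    · have := Real.exp_pos (-5)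
      simp [halfPlane, W_re]
      linarith
  · intro R
    refine isBounded_iff_forall_norm_le.2 ⟨R + 1, fun z hz => ?_⟩
    have h5 : ‖z‖ - ‖Complex.exp z‖ ≤ ‖W z‖ := norm_sub_norm_le _ _
    have := hlt z hz.1
    have := hz.2
    linarith
  · intro z hz hzT
    have h1 : z.re ≤ 0 :=
      closure_minimal (fun _ h => le_of_lt h) (isClosed_le Complex.continuous_re continuous_const) hz
    refine lt_of_le_of_ne h1 fun h0 => ?_
    simp only [halfPlane, mem_ofPred_eq, W_re, h0, Real.exp_zero] at hzT
    have := Real.cos_le_one z.im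
    linarith

lemma log_exp_of_mem_rightDomain {Y : ℂ} (hY : Y ∈ rightDomain) :
    Complex.log (Complex.exp Y) = Y := by
  have := abs_lt.1 hY.1
  exact Complex.log_exp (by linarith [Real.pi_pos]) (by linarith [Real.pi_pos])

/-- In the coordinate `z = e^Y` the domain lies in the convex half-plane `Re z > 1` and `W = log z -
z`, with `Re (1/z - 1) < 0`. On the boundary `Re W ≥ -1`: it is `Re Y ≥ 0` where `|Im Y| = π/2`, and
`Re Y - 1` where `Re e^Y = 1`. -/
lemma isSheet_rightSheet : IsSheet (-1) 1 rightSheet := by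
  have hcos : ∀ Y ∈ rightDomain, 0 < Y.re := fun Y hY => by
    have h1 : 1 < ‖Complex.exp Y‖ := hY.2.trans_le (Complex.re_le_norm _)
    rwa [Complex.norm_exp, Real.one_lt_exp_iff] at h1
  refine isSheet_of_domain ?_ ?_ ?_ ?_ ?_ (isBounded_of_abs_im_le ?_) ?_
  · exact (isOpen_lt (f := fun Y : ℂ => |Y.im|) (by fun_prop) continuous_const).and
      (isOpen_lt (g := fun Y : ℂ => (Complex.exp Y).re) continuous_const (by fun_prop))
  · intro Y hY
    simpa using hcos Y hY
  · intro Y hY h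
    have := hY.2
    simp [h] at this
  · have hinj : InjOn (fun z : ℂ => Complex.log z - z) {z | 1 < z.re} := by
      refine injOn_of_re_mul_deriv_pos (f' := fun z => z⁻¹ - 1) (convex_halfSpace_re_gt 1)
        (fun z hz => ?_) (-1) ?_
      · exact (Complex.hasDerivAt_log (Or.inl (zero_lt_one.trans hz))).sub (hasDerivAt_id z)
      · intro z hz
        have h1 : 1 < ‖z‖ := lt_of_lt_of_le hz (Complex.re_le_norm _)
        have h2 : z⁻¹.re ≤ ‖z‖⁻¹ := by rw [← norm_inv]; exact Complex.re_le_norm _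
        have h3 : ‖z‖⁻¹ < 1 := inv_lt_one_of_one_lt₀ h1
        simp only [Complex.mul_re, Complex.sub_re, Complex.one_re, Complex.neg_re, Complex.neg_im,
          Complex.one_im]
        linarith
    intro a ha b hb hab
    rw [← log_exp_of_mem_rightDomain ha, ← log_exp_of_mem_rightDomain hb]
    congr 1
    refine hinj ha.2 hb.2 ?_
    simpa only [log_exp_of_mem_rightDomain ha, log_exp_of_mem_rightDomain hb, W] using hab
  · have h1 := Real.exp_one_gt_d9
    refine ⟨1, ⟨?_, ?_⟩, ?_⟩
    · simp [Real.pi_pos]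
    · simp [Complex.exp_re]
    · simp [halfPlane, W_re]; linarith
  · intro Y hY
    have := hY.1
    linarith [Real.pi_lt_four]
  · intro z hz hzT
    have hz' : |z.im| ≤ Real.pi / 2 ∧ 1 ≤ (Complex.exp z).re :=
      closure_minimal (t := {z : ℂ | |z.im| ≤ Real.pi / 2} ∩ {z | 1 ≤ (Complex.exp z).re})
        (fun _ h => ⟨le_of_lt h.1, le_of_lt h.2⟩)
        ((isClosed_le (by fun_prop) continuous_const).inter
          (isClosed_le continuous_const (by fun_prop))) hz
    have h1 := hz'.2
    have h2 : 0 ≤ z.re := by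
      have h1 : 1 ≤ ‖Complex.exp z‖ := hz'.2.trans (Complex.re_le_norm _)
      rwa [Complex.norm_exp, Real.one_le_exp_iff] at h1
    simp only [halfPlane, mem_ofPred_eq, W_re] at hzT
    rw [Complex.exp_re] at h1
    refine ⟨lt_of_le_of_ne hz'.1 fun h => ?_, ?_⟩
    · rw [← Real.cos_abs, h, Real.cos_pi_div_two] at h1
      linarith
    · rw [Complex.exp_re]; linarith

/-- `Im W' = -e^x sin y` changes sign at `y = π`, so injectivity is proved on each half. The two
halves and the middle line have disjoint images, as `Im W` is below, above or equal to `π`; on the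
line, `Re W = x + e^x` is strictly increasing. On the boundary lines `Re W = x - e^x ≤ -1`. -/
lemma isSheet_stripSheet_zero : IsSheet 1 Complex.I (stripSheet 0) := by
  have hpi := Real.pi_pos
  have hstrip : ∀ Y, Y ∈ strip 0 ↔ 0 < Y.im ∧ Y.im < 2 * Real.pi := fun Y => by simp [strip]
  have hlow : InjOn W {Y | Y.im ∈ Ioo 0 Real.pi} := by
    refine injOn_of_re_mul_deriv_pos ?_ (fun z _ => hasDerivAt_W z) Complex.I ?_
    · exact (convex_halfSpace_im_gt 0).inter (convex_halfSpace_im_lt Real.pi)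
    · intro z hz
      have := mul_pos (Real.exp_pos z.re) (Real.sin_pos_of_mem_Ioo hz)
      simpa [Complex.exp_im] using this
  have hhigh : InjOn W {Y | Y.im ∈ Ioo Real.pi (2 * Real.pi)} := by
    refine injOn_of_re_mul_deriv_pos ?_ (fun z _ => hasDerivAt_W z) (-Complex.I) ?_
    · exact (convex_halfSpace_im_gt _).inter (convex_halfSpace_im_lt _)
    · intro z hz
      have h := Real.sin_neg_of_neg_of_neg_pi_lt (x := z.im - 2 * Real.pi)
        (by linarith [hz.2]) (by linarith [hz.1])
      rw [Real.sin_sub_two_pi] at h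
      have := mul_pos (Real.exp_pos z.re) (neg_pos.2 h)
      simpa [Complex.exp_im] using this
  have hs1 : ∀ Y : ℂ, 0 < Y.im → Y.im < Real.pi → (W Y).im < Real.pi := fun Y h1 h2 => by
    have := mul_pos (Real.exp_pos Y.re) (Real.sin_pos_of_mem_Ioo ⟨h1, h2⟩)
    rw [W_im]; linarith
  have hs2 : ∀ Y : ℂ, Real.pi < Y.im → Y.im < 2 * Real.pi → Real.pi < (W Y).im := fun Y h1 h2 => by
    have h := Real.sin_neg_of_neg_of_neg_pi_lt (x := Y.im - 2 * Real.pi)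
      (by linarith) (by linarith)
    rw [Real.sin_sub_two_pi] at h
    have := mul_pos (Real.exp_pos Y.re) (neg_pos.2 h)
    rw [W_im]; linarith
  have hs3 : ∀ Y : ℂ, Y.im = Real.pi → (W Y).im = Real.pi := fun Y h => by simp [W_im, h]
  refine isSheet_of_domain ?_ ?_ ?_ ?_ ?_ (isBounded_of_abs_im_le ?_) ?_
  · exact isOpen_Ioo.preimage Complex.continuous_im
  · intro Y hY
    simpa using ((hstrip Y).1 hY).1
  · intro Y hY h
    obtain ⟨h1, h2⟩ := (hstrip Y).1 hY
    obtain ⟨n, rfl⟩ := Complex.exp_eq_one_iff.1 h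
    simp only [Complex.mul_im, Complex.mul_re, Complex.intCast_re, Complex.intCast_im,
      Complex.ofReal_re, Complex.ofReal_im, Complex.I_re, Complex.I_im, Complex.re_ofNat,
      Complex.im_ofNat] at h1 h2
    have h3 : (0 : ℝ) < n := by nlinarith
    have h4 : (n : ℝ) < 1 := by nlinarith
    norm_cast at h3 h4
    omega
  · intro a ha b hb hab
    obtain ⟨a1, a2⟩ := (hstrip a).1 ha
    obtain ⟨b1, b2⟩ := (hstrip b).1 hb
    have him : (W a).im = (W b).im := by rw [hab]
    rcases lt_trichotomy a.im Real.pi with h | h | h <;>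
    rcases lt_trichotomy b.im Real.pi with h' | h' | h'
    · exact hlow ⟨a1, h⟩ ⟨b1, h'⟩ hab
    · linarith [hs1 a a1 h, hs3 b h']
    · linarith [hs1 a a1 h, hs2 b h' b2]
    · linarith [hs1 b b1 h', hs3 a h]
    · refine Complex.ext ?_ (h.trans h'.symm)
      have hre : (W a).re = (W b).re := by rw [hab]
      simp only [W_re, h, h', Real.cos_pi] at hre
      rcases lt_trichotomy a.re b.re with h3 | h3 | h3
      · linarith [Real.exp_lt_exp.2 h3]
      · exact h3
      · linarith [Real.exp_lt_exp.2 h3]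
    · linarith [hs2 b h' b2, hs3 a h]
    · linarith [hs1 b b1 h', hs2 a h a2]
    · linarith [hs2 a h a2, hs3 b h']
    · exact hhigh ⟨h, a2⟩ ⟨h', b2⟩ hab
  · refine ⟨Real.pi * Complex.I, ?_, ?_⟩
    · rw [hstrip]; simp; constructor <;> linarith
    · simp [halfPlane, W_re]
  · intro Y hY
    obtain ⟨h1, h2⟩ := (hstrip Y).1 hY
    rw [abs_of_pos h1]
    linarith [Real.pi_lt_d2]
  · intro z hz hzT
    have hz' : 0 ≤ z.im ∧ z.im ≤ 2 * Real.pi :=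
      closure_minimal (t := {z : ℂ | 0 ≤ z.im} ∩ {z | z.im ≤ 2 * Real.pi})
        (fun Y h => ⟨((hstrip Y).1 h).1.le, ((hstrip Y).1 h).2.le⟩)
        ((isClosed_le continuous_const Complex.continuous_im).inter
          (isClosed_le Complex.continuous_im continuous_const)) hz
    simp only [halfPlane, mem_ofPred_eq, W_re] at hzT
    have hexp := Real.add_one_le_exp z.re
    rw [hstrip]
    constructor
    · refine lt_of_le_of_ne hz'.1 fun h => ?_
      rw [← h, Real.cos_zero] at hzT
      linarith
    · refine lt_of_le_of_ne hz'.2 fun h => ?_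
      rw [h, Real.cos_two_pi] at hzT
      linarith

/-! ### Translates of sheets and the pairs of sheets at a critical point -/

lemma mem_strip_sub_crit {Y : ℂ} {m k : ℤ} : Y - crit k ∈ strip m ↔ Y ∈ strip (m + k) := by
  simp only [strip, mem_ofPred_eq, mem_Ioo, Complex.sub_im, crit_im]
  push_cast
  constructor <;> rintro ⟨h1, h2⟩ <;> constructor <;> linarith

lemma W_sub_crit (Y : ℂ) (k : ℤ) : W (Y - crit k) = W Y - crit k := by
  rw [eq_sub_iff_add_eq, ← W_add_crit, sub_add_cancel]

lemma mem_halfPlane_sub_crit {η : ℝ} {w : ℂ} {k : ℤ} :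
    w - crit k ∈ halfPlane η ↔ w ∈ halfPlane η := by simp [halfPlane]

lemma mem_stripSheet_sub_crit {Y : ℂ} {m k : ℤ} :
    Y - crit k ∈ stripSheet m ↔ Y ∈ stripSheet (m + k) := by
  simp only [stripSheet, mem_inter_iff, mem_strip_sub_crit, mem_preimage, W_sub_crit,
    mem_halfPlane_sub_crit]

lemma mem_leftSheet_sub_crit {Y : ℂ} {k : ℤ} : Y - crit k ∈ leftSheet ↔ Y ∈ leftSheet := by
  simp only [leftSheet, leftDomain, mem_inter_iff, mem_ofPred_eq, Complex.sub_re, crit_re, sub_zero,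
    mem_preimage, W_sub_crit, mem_halfPlane_sub_crit]

lemma isSheet_stripSheet_neg_one : IsSheet 1 (-Complex.I) (stripSheet (-1)) where
  isOpen := (isOpen_Ioo.preimage Complex.continuous_im).inter
    ((isOpen_halfPlane 1).preimage continuous_W)
  re_pos Y hY := by
    have : Y.im < 0 := by simpa using hY.1.2
    simpa using this
  exp_ne_one Y hY := by
    have h := isSheet_stripSheet_zero.exp_ne_one (Y - crit (-1))
      (by rwa [mem_stripSheet_sub_crit, zero_add])
    rwa [← exp_add_crit _ (-1), sub_add_cancel] at h
  bijOn := by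
    have h0 := isSheet_stripSheet_zero.bijOn
    refine ⟨fun Y h => h.2, fun a ha b hb hab => ?_, fun w hw => ?_⟩
    · have := h0.injOn (mem_stripSheet_sub_crit.2 ((zero_add (-1 : ℤ)).symm ▸ ha))
        (mem_stripSheet_sub_crit.2 ((zero_add (-1 : ℤ)).symm ▸ hb)) (by simp [W_sub_crit, hab])
      exact sub_left_injective this
    · obtain ⟨Y, hY, hYw⟩ := h0.surjOn (mem_halfPlane_sub_crit (k := -1).2 hw)
      refine ⟨Y + crit (-1), ?_, by simp [W_add_crit, hYw]⟩
      have := mem_stripSheet_sub_crit (Y := Y + crit (-1)) (m := 0) (k := -1)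
      rw [add_sub_cancel_right, zero_add] at this
      exact this.1 hY

/-- The two sheets adjacent to the critical point `0`, and a separation of the preimage of the
half-plane into a neighbourhood of these sheets and a remaining part. -/
structure IsSheetPair (η : ℝ) (μ : ℂ) (U V G H : Set ℂ) : Prop where
  left : IsSheet η μ U
  right : IsSheet η (-μ) V
  isOpen_near : IsOpen G
  isOpen_far : IsOpen H
  disjoint : Disjoint G H
  zero_mem : 0 ∈ G
  cover : ∀ Y, W Y ∈ halfPlane η → Y ∈ G ∪ H
  near : ∀ Y, W Y ∈ halfPlane η → Y ∈ G → Y ∈ U ∪ V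

/-- The near set must contain `0`, which is only a boundary point of the sheets, so it is larger
than their union. The translates of the right sheet to the other critical points fall in the far
set. -/
lemma isSheetPair_left_right : IsSheetPair (-1) 1 rightSheet leftSheet
    {Y | Y.re < 0 ∨ |Y.im| < Real.pi / 2} {Y | 0 < Y.re ∧ Real.pi / 2 < |Y.im|} where
  left := isSheet_rightSheet
  right := isSheet_leftSheet
  isOpen_near := (isOpen_lt Complex.continuous_re continuous_const).union
    (isOpen_lt (f := fun Y : ℂ => |Y.im|) (by fun_prop) continuous_const)
  isOpen_far := (isOpen_lt continuous_const Complex.continuous_re).and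
    (isOpen_lt (g := fun Y : ℂ => |Y.im|) continuous_const (by fun_prop))
  disjoint := by
    rw [Set.disjoint_left]
    rintro Y (h | h) ⟨h1, h2⟩ <;> linarith
  zero_mem := Or.inr (by simp [Real.pi_pos])
  cover Y hY := by
    simp only [halfPlane, mem_ofPred_eq, W_re] at hY
    rcases lt_or_ge Y.re 0 with h | h
    · exact Or.inl (Or.inl h)
    · rcases lt_trichotomy |Y.im| (Real.pi / 2) with h' | h' | h'
      · exact Or.inl (Or.inr h')
      · rw [← Real.cos_abs, h', Real.cos_pi_div_two] at hY
        linarith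
      · refine Or.inr ⟨lt_of_le_of_ne h fun h0 => ?_, h'⟩
        rw [← h0, Real.exp_zero] at hY
        linarith [Real.cos_le_one Y.im]
  near Y hY hG := by
    rcases lt_or_ge Y.re 0 with h | h
    · exact Or.inr ⟨h, hY⟩
    · refine Or.inl ⟨⟨hG.resolve_left h.not_gt, ?_⟩, hY⟩
      simp only [halfPlane, mem_ofPred_eq, W_re] at hY
      rw [Complex.exp_re]
      linarith

lemma im_ne_of_W_mem_halfPlane {Y : ℂ} (hY : W Y ∈ halfPlane 1) (k : ℤ) :
    Y.im ≠ 2 * Real.pi * k := by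
  intro h
  have h1 := Real.cos_int_mul_two_pi k
  simp only [halfPlane, mem_ofPred_eq, W_re, h, mul_comm (2 * Real.pi), h1] at hY
  linarith [Real.add_one_le_exp Y.re]

lemma isSheetPair_strips : IsSheetPair 1 Complex.I (stripSheet 0) (stripSheet (-1))
    {Y | |Y.im| < 2 * Real.pi} {Y | 2 * Real.pi < |Y.im|} where
  left := isSheet_stripSheet_zero
  right := isSheet_stripSheet_neg_one
  isOpen_near := isOpen_lt (by fun_prop) continuous_const
  isOpen_far := isOpen_lt continuous_const (by fun_prop)
  disjoint := by
    rw [Set.disjoint_left]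
    intro Y (h : |Y.im| < _) (h' : _ < |Y.im|)
    exact lt_asymm h h'
  zero_mem := by simp [Real.pi_pos]
  cover Y hY := by
    refine lt_or_gt_of_ne (a := |Y.im|) (b := 2 * Real.pi) fun h => ?_
    rcases eq_or_eq_neg_of_abs_eq h with h | h
    · exact im_ne_of_W_mem_halfPlane hY 1 (by simpa using h)
    · exact im_ne_of_W_mem_halfPlane hY (-1) (by simpa using h)
  near Y hY hG := by
    obtain ⟨h1, h2⟩ := abs_lt.1 (show |Y.im| < 2 * Real.pi from hG)
    rcases lt_or_gt_of_ne (im_ne_of_W_mem_halfPlane hY 0) with h | h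
    · exact Or.inr ⟨⟨by simpa using h1, by simpa using h⟩, hY⟩
    · exact Or.inl ⟨⟨by simpa using h, by simpa using h2⟩, hY⟩

/-! ### Regular parametrizations of the thimbles -/

/-- The superpotential in a Morse coordinate near the critical point `0`. -/
lemma exists_morse_inverse : ∃ ψ : ℂ → ℂ, ContDiffAt ℂ 1 ψ 0 ∧ HasDerivAt ψ 1 0 ∧ ψ 0 = 0 ∧
    ∀ᶠ z in 𝓝 0, W (ψ z) = -1 - z ^ 2 / 2 := by
  -- `f = -2 (W + 1)`. Two divided differences give `f = Y² h`, and `g = Y √h` is the Morse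
  -- coordinate to be inverted.
  set f : ℂ → ℂ := fun Y => 2 * (Complex.exp Y - 1 - Y) with hf
  have hfd : ∀ Y, HasDerivAt f (2 * (Complex.exp Y - 1)) Y := fun Y =>
    (((Complex.hasDerivAt_exp Y).sub_const 1).sub (hasDerivAt_id Y)).const_mul 2
  have hd : ∀ g : ℂ → ℂ, Differentiable ℂ g → Differentiable ℂ (dslope g 0) := fun g hg =>
    differentiableOn_univ.1 ((Complex.differentiableOn_dslope univ_mem).2 hg.differentiableOn)
  set h : ℂ → ℂ := dslope (dslope f 0) 0 with hh
  have hhd : Differentiable ℂ h := hd _ (hd _ fun Y => (hfd Y).differentiableAt)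
  have h1 : ∀ Y, f Y = Y * (Y * h Y) := fun Y => by
    have e1 := sub_smul_dslope (dslope f 0) 0 Y
    have e2 := sub_smul_dslope f 0 Y
    rw [dslope_same, (hfd 0).deriv] at e1
    simp only [sub_zero, smul_eq_mul, Complex.exp_zero, sub_self, mul_zero] at e1 e2
    rw [hh, e1, e2, hf]
    simp
  have h0 : h 0 = 1 := by
    have hdh : Differentiable ℂ (deriv h) := fun z => (hhd.analyticAt z).deriv.differentiableAt
    -- Differentiating `f = Y² h` and halving; a second differentiation at `0` yields `h 0 = 1`.
    have e1 : ∀ Y, Complex.exp Y - 1 = Y * (h Y + Y * deriv h Y / 2) := fun Y => by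
      have e2 : HasDerivAt f (1 * (Y * h Y) + Y * (1 * h Y + Y * deriv h Y)) Y :=
        ((hasDerivAt_id Y).mul ((hasDerivAt_id Y).mul (hhd Y).hasDerivAt)).congr_of_eventuallyEq
          (Eventually.of_forall h1)
      have := (hfd Y).unique e2
      linear_combination this / 2
    have e3 : HasDerivAt (fun Y => Complex.exp Y - 1)
        (1 * (h 0 + 0 * deriv h 0 / 2) + 0 * deriv (fun Y => h Y + Y * deriv h Y / 2) 0) 0 := by
      have e4 : DifferentiableAt ℂ (fun Y => h Y + Y * deriv h Y / 2) 0 := by fun_prop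
      exact ((hasDerivAt_id (0 : ℂ)).mul e4.hasDerivAt).congr_of_eventuallyEq
        (Eventually.of_forall e1)
    have := ((Complex.hasDerivAt_exp 0).sub_const 1).unique e3
    simpa using this.symm
  set g : ℂ → ℂ := fun Y => Y * h Y ^ ((2 : ℕ)⁻¹ : ℂ) with hg
  have hga : AnalyticAt ℂ g 0 :=
    analyticAt_id.mul ((hhd.analyticAt 0).cpow analyticAt_const (by simp [h0]))
  have hgc : ContDiffAt ℂ 1 g 0 := hga.contDiffAt
  have hgd : HasDerivAt g 1 0 := by
    have e1 : DifferentiableAt ℂ (fun Y => h Y ^ ((2 : ℕ)⁻¹ : ℂ)) 0 :=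
      ((hhd.analyticAt 0).cpow analyticAt_const (by simp [h0])).differentiableAt
    exact ((hasDerivAt_id (0 : ℂ)).mul e1.hasDerivAt).congr_deriv (by simp [h0])
  have hg0 : g 0 = 0 := by simp [hg]
  have hgs := hgc.hasStrictDerivAt' hgd one_ne_zero
  have hfe := hgs.hasStrictFDerivAt_equiv one_ne_zero
  refine ⟨hgc.localInverse (f' := ContinuousLinearEquiv.unitsEquivAut ℂ (Units.mk0 1 one_ne_zero))
    hfe.hasFDerivAt one_ne_zero, ?_, ?_, ?_, ?_⟩
  · have := hgc.to_localInverse (f' := ContinuousLinearEquiv.unitsEquivAut ℂ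
      (Units.mk0 1 one_ne_zero)) hfe.hasFDerivAt one_ne_zero
    rwa [hg0] at this
  · have := (hgs.to_localInverse one_ne_zero).hasDerivAt
    rw [hg0, inv_one] at this
    exact this
  · have := hgc.localInverse_apply_image (f' := ContinuousLinearEquiv.unitsEquivAut ℂ
      (Units.mk0 1 one_ne_zero)) hfe.hasFDerivAt one_ne_zero
    rwa [hg0] at this
  · have := hgs.eventually_right_inverse one_ne_zero
    rw [hg0] at this
    filter_upwards [this] with z hz
    generalize hY : hgs.localInverse g 1 0 one_ne_zero z = Y at hz
    have hY' : hgc.localInverse (f' := ContinuousLinearEquiv.unitsEquivAut ℂ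
      (Units.mk0 1 one_ne_zero)) hfe.hasFDerivAt one_ne_zero z = Y := hY
    rw [hY', ← hz, hg]
    simp only [mul_pow, Complex.cpow_nat_inv_pow _ two_ne_zero]
    have := h1 Y
    simp only [hf] at this
    rw [W]
    linear_combination -this / 2

/-- The inverse of `W` on a sheet. -/
lemma IsSheet.exists_inverse {η : ℝ} {μ : ℂ} {U : Set ℂ} (h : IsSheet η μ U) :
    ∃ B : ℂ → ℂ, (∀ w ∈ halfPlane η, B w ∈ U ∧ W (B w) = w ∧ ContDiffAt ℂ 1 B w) := by
  have hB : ∀ w ∈ halfPlane η, Function.invFunOn W U w ∈ U ∧ W (Function.invFunOn W U w) = w :=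
    fun w hw => ⟨Function.invFunOn_mem (h.bijOn.surjOn hw), Function.invFunOn_eq (h.bijOn.surjOn hw)⟩
  refine ⟨Function.invFunOn W U, fun w hw => ⟨(hB w hw).1, (hB w hw).2, ?_⟩⟩
  obtain ⟨hU, hW⟩ := hB w hw
  set Y := Function.invFunOn W U w
  have hY : (1 - Complex.exp Y) ≠ 0 := sub_ne_zero.2 (h.exp_ne_one Y hU).symm
  have hc : ContDiffAt ℂ 1 W Y := (contDiff_id.sub Complex.contDiff_exp).contDiffAt
  have hs := hasStrictDerivAt_W Y
  have hfe := hs.hasStrictFDerivAt_equiv hY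
  have h1 := hc.to_localInverse hfe.hasFDerivAt one_ne_zero
  have h2 := hc.localInverse_apply_image hfe.hasFDerivAt one_ne_zero
  have h3 := hs.eventually_right_inverse hY
  rw [hW] at h1 h2 h3
  refine h1.congr_of_eventuallyEq ?_
  -- The local inverse stays in the sheet, so injectivity of `W` there identifies it with the global
  -- one.
  have h4 : ∀ᶠ w' in 𝓝 w, hc.localInverse hfe.hasFDerivAt one_ne_zero w' ∈ U :=
    h1.continuousAt.eventually_mem (by rw [h2]; exact h.isOpen.mem_nhds hU)
  filter_upwards [h3, h4, (isOpen_halfPlane η).mem_nhds hw] with w' e1 e2 e3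
  exact h.bijOn.injOn (hB w' e3).1 e2 ((hB w' e3).2.trans e1.symm)

/-- `γ` is a regular curve through the critical point `0` in the direction `σ`, whose
values under `W` run through the ray `-1 + ζ ℝ≥0` twice, once in each of the sheets `U` and `V`. -/
structure IsThimbleParam (ζ σ : ℂ) (U V : Set ℂ) (γ : ℝ → ℂ) : Prop where
  contDiff : ContDiff ℝ 1 γ
  W_eq : ∀ s : ℝ, W (γ s) = -1 + ζ * s ^ 2
  mem_of_pos : ∀ s, 0 < s → γ s ∈ U
  mem_of_neg : ∀ s, s < 0 → γ s ∈ V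
  map_zero : γ 0 = 0
  deriv_zero : ∃ c : ℝ, 0 < c ∧ deriv γ 0 = c • σ

lemma ray_mem_halfPlane {η : ℝ} {ζ : ℂ} (hζ : 0 < η * ζ.re) {s : ℝ} (hs : s ≠ 0) :
    -1 + ζ * (s : ℂ) ^ 2 ∈ halfPlane η := by
  have h : (ζ * (s : ℂ) ^ 2).re = ζ.re * s ^ 2 := by
    rw [← Complex.ofReal_pow, Complex.re_mul_ofReal]
  simp only [halfPlane, mem_ofPred_eq, Complex.add_re, h, Complex.neg_re, Complex.one_re]
  have := mul_pos hζ (pow_pos (abs_pos.2 hs) 2)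
  rw [sq_abs] at this
  linarith

/-- Away from `0` the curve lifts the ray by the inverse of `W` on each sheet. Near `0` it equals `ψ
(√2 σ s)`, over which `W = -1 - σ² s² = -1 + ζ s²`; the sign of `Re (conj μ ·)` tells the sheets
apart and agrees there with the sign of `s` because `Re (conj μ σ) > 0`. -/
lemma IsSheetPair.exists_isThimbleParam {η : ℝ} {μ ζ σ : ℂ} {U V G H : Set ℂ}
    (h : IsSheetPair η μ U V G H) (hζ : 0 < η * ζ.re) (hσ : σ ^ 2 = -ζ)
    (hμ : 0 < (conj μ * σ).re) : ∃ γ, IsThimbleParam ζ σ U V γ := by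
  obtain ⟨B, hB⟩ := h.left.exists_inverse
  obtain ⟨C, hC⟩ := h.right.exists_inverse
  obtain ⟨ψ, hψc, hψd, hψ0, hψ⟩ := exists_morse_inverse
  have hT : ∀ s : ℝ, s ≠ 0 → -1 + ζ * (s : ℂ) ^ 2 ∈ halfPlane η :=
    fun s hs => ray_mem_halfPlane hζ hs
  set γ : ℝ → ℂ := fun s => if 0 < s then B (-1 + ζ * s ^ 2) else
    if s < 0 then C (-1 + ζ * s ^ 2) else 0 with hγ
  have hpos : ∀ s, 0 < s → γ s = B (-1 + ζ * s ^ 2) := fun s hs => by simp [hγ, hs]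
  have hneg : ∀ s, s < 0 → γ s = C (-1 + ζ * s ^ 2) := fun s hs => by simp [hγ, hs, hs.not_gt]
  have hzero : γ 0 = 0 := by simp [hγ]
  have hlin : HasDerivAt (fun s : ℝ => (√2 : ℂ) * σ * s) ((√2 : ℂ) * σ) 0 := by
    simpa using (Complex.ofRealCLM.hasDerivAt (x := 0)).const_mul ((√2 : ℂ) * σ)
  have hlc : ContinuousAt (fun s : ℝ => (√2 : ℂ) * σ * s) 0 := hlin.continuousAt
  have hloc0 : HasDerivAt (fun s : ℝ => ψ ((√2 : ℂ) * σ * s)) ((√2 : ℂ) * σ) 0 := by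
    have h1 : HasDerivAt ψ 1 ((√2 : ℂ) * σ * (0 : ℝ)) := by simpa using hψd
    exact (h1.comp (0 : ℝ) hlin).congr_deriv (one_mul _)
  have hlocW : ∀ᶠ s : ℝ in 𝓝 0, W (ψ ((√2 : ℂ) * σ * s)) = -1 + ζ * s ^ 2 := by
    have h1 : Tendsto (fun s : ℝ => (√2 : ℂ) * σ * s) (𝓝 0) (𝓝 0) := by
      simpa [ContinuousAt] using hlc
    filter_upwards [h1.eventually hψ] with s hs
    have h2 : ((√2 : ℝ) : ℂ) ^ 2 = 2 := by
      rw [← Complex.ofReal_pow, Real.sq_sqrt zero_le_two]; norm_num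
    rw [hs, mul_pow, mul_pow, h2, hσ]
    ring
  have hlocG : ∀ᶠ s : ℝ in 𝓝 0, ψ ((√2 : ℂ) * σ * s) ∈ G :=
    hloc0.continuousAt.eventually_mem (by simpa [hψ0] using h.isOpen_near.mem_nhds h.zero_mem)
  have hlocS : ∀ᶠ s : ℝ in 𝓝 0,
      SignType.sign (conj μ * ψ ((√2 : ℂ) * σ * s)).re = SignType.sign s := by
    have h1 : HasDerivAt (fun s : ℝ => (conj μ * ψ ((√2 : ℂ) * σ * s)).re)
        (conj μ * ((√2 : ℂ) * σ)).re 0 :=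
      Complex.reCLM.hasFDerivAt.comp_hasDerivAt (0 : ℝ) (hloc0.const_mul (conj μ))
    have h2 : 0 < (conj μ * ((√2 : ℂ) * σ)).re := by
      rw [mul_left_comm, Complex.re_ofReal_mul]
      positivity
    have := eventually_nhdsWithin_sign_eq_of_deriv_pos (by rwa [h1.deriv]) (by simp [hψ0])
    simpa using this
  have hγψ : γ =ᶠ[𝓝 0] fun s : ℝ => ψ ((√2 : ℂ) * σ * s) := by
    filter_upwards [hlocW, hlocG, hlocS] with s e1 e2 e3
    rcases lt_trichotomy s 0 with hs | hs | hs
    · rw [hneg s hs]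
      have hm := hT s hs.ne
      rw [sign_neg hs, sign_eq_neg_one_iff] at e3
      rcases h.near _ (e1 ▸ hm) e2 with h' | h'
      · exact absurd (h.left.re_pos _ h') e3.not_gt
      · exact h.right.bijOn.injOn (hC _ hm).1 h' ((hC _ hm).2.1.trans e1.symm)
    · simp [hs, hzero, hψ0]
    · rw [hpos s hs]
      have hm := hT s hs.ne'
      rw [sign_pos hs, sign_eq_one_iff] at e3
      rcases h.near _ (e1 ▸ hm) e2 with h' | h'
      · exact h.left.bijOn.injOn (hB _ hm).1 h' ((hB _ hm).2.1.trans e1.symm)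
      · have := h.right.re_pos _ h'
        simp only [map_neg, neg_mul, Complex.neg_re] at this
        linarith
  refine ⟨γ, ?_, ?_, ?_, ?_, hzero, √2, by positivity, ?_⟩
  · have hray : ∀ s : ℝ, ContDiffAt ℝ 1 (fun s : ℝ => -1 + ζ * (s : ℂ) ^ 2) s := fun s =>
      (contDiff_const.add (contDiff_const.mul (Complex.ofRealCLM.contDiff.pow 2))).contDiffAt
    refine contDiff_iff_contDiffAt.2 fun s => ?_
    rcases lt_trichotomy s 0 with hs | rfl | hs
    · refine ((hC _ (hT s hs.ne)).2.2.restrict_scalars ℝ |>.comp s (hray s)).congr_of_eventuallyEq ?_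
      filter_upwards [gt_mem_nhds hs] with t ht using hneg t ht
    · refine ContDiffAt.congr_of_eventuallyEq ?_ hγψ
      have h1 : ContDiffAt ℝ 1 ψ ((√2 : ℂ) * σ * (0 : ℝ)) := by
        simpa using hψc.restrict_scalars ℝ
      exact h1.comp (0 : ℝ) (contDiff_const.mul Complex.ofRealCLM.contDiff).contDiffAt
    · refine ((hB _ (hT s hs.ne')).2.2.restrict_scalars ℝ |>.comp s (hray s)).congr_of_eventuallyEq ?_
      filter_upwards [lt_mem_nhds hs] with t ht using hpos t ht
  · intro s
    rcases lt_trichotomy s 0 with hs | rfl | hs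
    · rw [hneg s hs]; exact (hC _ (hT s hs.ne)).2.1
    · simp [hzero]
    · rw [hpos s hs]; exact (hB _ (hT s hs.ne')).2.1
  · intro s hs
    rw [hpos s hs]; exact (hB _ (hT s hs.ne')).1
  · intro s hs
    rw [hneg s hs]; exact (hC _ (hT s hs.ne)).1
  · rw [hγψ.deriv_eq, hloc0.deriv, Complex.real_smul]

/-! ### Identification of the parametrized curves with the thimbles -/

/-- Separation of variables: `τ` inverts `y ↦ ∫ m`, and the lower bound `c` makes this integral a
bijection of `ℝ`. -/
lemma exists_hasDerivAt_inv {m : ℝ → ℝ} (hm : Continuous m) {c : ℝ} (hc : 0 < c)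
    (hcm : ∀ y, c ≤ m y) (y₀ : ℝ) :
    ∃ τ : ℝ → ℝ, τ 0 = y₀ ∧ (∀ x, HasDerivAt τ (m (τ x))⁻¹ x) ∧ Monotone τ ∧
      Tendsto τ atBot atBot := by
  set X : ℝ → ℝ := fun y => ∫ z in y₀..y, m z with hX
  have hd : ∀ y, HasDerivAt X (m y) y := fun y => (hm.integral_hasStrictDerivAt y₀ y).hasDerivAt
  have hpos : ∀ y, 0 < m y := fun y => hc.trans_le (hcm y)
  have hmono : StrictMono X := strictMono_of_deriv_pos fun y => by rw [(hd y).deriv]; exact hpos y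
  have hX0 : X y₀ = 0 := by simp [hX]
  have hmono' : Monotone fun y => X y - c * y := by
    have h1 : ∀ y, HasDerivAt (fun y => X y - c * y) (m y - c * 1) y := fun y =>
      (hd y).sub ((hasDerivAt_id y).const_mul c)
    refine monotone_of_deriv_nonneg (fun y => (h1 y).differentiableAt) fun y => ?_
    rw [(h1 y).deriv]
    linarith [hcm y]
  have htop : Tendsto X atTop atTop := by
    have h1 : Tendsto (fun y => c * y + -(c * y₀)) atTop atTop :=
      tendsto_atTop_add_const_right _ _ (tendsto_id.const_mul_atTop hc)
    refine tendsto_atTop_mono' _ ?_ h1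
    filter_upwards [eventually_ge_atTop y₀] with y hy
    have := hmono' hy
    simp only [hX0] at this
    linarith
  have hbot : Tendsto X atBot atBot := by
    have h1 : Tendsto (fun y => c * y + -(c * y₀)) atBot atBot :=
      tendsto_atBot_add_const_right _ _ (tendsto_id.const_mul_atBot hc)
    refine tendsto_atBot_mono' _ ?_ h1
    filter_upwards [eventually_le_atBot y₀] with y hy
    have := hmono' hy
    simp only [hX0] at this
    linarith
  have hcont : Continuous X := continuous_iff_continuousAt.2 fun y => (hd y).continuousAt
  set e := hmono.orderIsoOfSurjective X (hcont.surjective htop hbot) with he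
  have heX : ∀ x, X (e.symm x) = x := fun x => e.apply_symm_apply x
  refine ⟨e.symm, ?_, fun x => ?_, e.symm.monotone, e.symm.tendsto_atBot⟩
  · rw [OrderIso.symm_apply_eq]
    exact hX0.symm
  · exact (hd _).of_local_left_inverse e.symm.continuous.continuousAt (hpos _).ne'
      (Eventually.of_forall heX)

/-- From `W' γ' = 2sζ` the gradient field on the curve is `(2s / |γ'|²) γ'`. Thus `log s` must
satisfy `τ' = 2 / |γ'|²`, and `τ → -∞` means `s → 0`. -/
lemma mem_L_of_deriv_eq {γ : ℝ → ℂ} {ζ : ℂ} (hζ : ‖ζ‖ = 1) (hγ : ContDiff ℝ 1 γ)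
    (hne : ∀ s, deriv γ s ≠ 0) (h0 : γ 0 = 0)
    (hW : ∀ s : ℝ, (1 - Complex.exp (γ s)) * deriv γ s = 2 * s * ζ) {s₀ : ℝ} (hs₀ : 0 < s₀) :
    γ s₀ ∈ L 0 ζ := by
  have hdc : Continuous (deriv γ) := hγ.continuous_deriv le_rfl
  obtain ⟨s₁, -, hmin⟩ := isCompact_Icc.exists_isMinOn (nonempty_Icc.2 hs₀.le)
    (hdc.norm.continuousOn (s := Icc 0 s₀))
  obtain ⟨τ, hτ0, hτd, hτm, hτl⟩ := exists_hasDerivAt_inv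
    -- Truncating at `s₀` makes the speed bounded below on all of `ℝ`; it has no effect at times `x
    -- ≤ 0`, where `τ x ≤ log s₀`.
    (m := fun y => ‖deriv γ (min (Real.exp y) s₀)‖ ^ 2 / 2) (by fun_prop)
    (c := ‖deriv γ s₁‖ ^ 2 / 2) (by have := norm_pos_iff.2 (hne s₁); positivity) (fun y => by
      have h1 : min (Real.exp y) s₀ ∈ Icc 0 s₀ :=
        ⟨le_min (Real.exp_pos y).le hs₀.le, min_le_right _ _⟩
      have h2 := hmin h1
      simp only [mem_ofPred_eq] at h2
      gcongr) (Real.log s₀)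
  refine ⟨fun x => γ (Real.exp (τ x)), fun x hx => ?_, by simp [hτ0, Real.exp_log hs₀], ?_⟩
  · apply HasDerivAt.hasDerivWithinAt
    have h1 := (((hγ.differentiable one_ne_zero).differentiableAt (x := Real.exp (τ x))).hasDerivAt).scomp x
      (hτd x).exp
    have hle : Real.exp (τ x) ≤ s₀ := by
      rw [← Real.exp_log hs₀, ← hτ0]
      exact Real.exp_le_exp.2 (hτm hx)
    refine h1.congr_deriv ?_
    change _ = gradField ζ (γ (Real.exp (τ x)))
    rw [min_eq_left hle, gradField_apply hζ]
    set s := Real.exp (τ x)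
    have h2 : 1 - Complex.exp (γ s) = 2 * s * ζ / deriv γ s := by
      rw [eq_div_iff (hne s), hW]
    have h3 : conj (deriv γ s) ≠ 0 := (map_ne_zero _).2 (hne s)
    have h4 : ((‖deriv γ s‖ : ℝ) : ℂ) ^ 2 = deriv γ s * conj (deriv γ s) := by
      rw [Complex.mul_conj, Complex.normSq_eq_norm_sq]; push_cast; rfl
    rw [h2, map_div₀, map_mul, map_mul, Complex.conj_ofReal, Complex.real_smul]
    push_cast
    rw [h4, map_ofNat]
    have h5 := mul_conj_of_norm_eq_one hζ
    have h6 := hne s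
    field_simp
    linear_combination -(s : ℂ) * h5
  · have h1 : Tendsto (fun x => γ (Real.exp (τ x))) atBot (𝓝 (γ 0)) :=
      (hγ.continuous.tendsto 0).comp (Real.tendsto_exp_atBot.comp hτl)
    simpa [h0] using h1

lemma eq_of_hasDerivWithinAt_zero {E : Type*} [NormedAddCommGroup E] [NormedSpace ℝ E] {f : ℝ → E}
    {x : ℝ} {a : E} (hf : ∀ y ∈ Iic x, HasDerivWithinAt f 0 (Iic x) y)
    (hlim : Tendsto f atBot (𝓝 a)) : f x = a := by
  refine tendsto_nhds_unique_of_eventuallyEq tendsto_const_nhds hlim ?_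
  filter_upwards [eventually_le_atBot x] with y hy
  have := (convex_Iic x).norm_image_sub_le_of_norm_hasDerivWithin_le (C := 0) hf
    (fun _ _ => norm_zero.le) hy self_mem_Iic
  rw [zero_mul, norm_le_zero_iff, sub_eq_zero] at this
  exact this

lemma IsSheetPair.disjoint_sheets {η : ℝ} {μ : ℂ} {U V G H : Set ℂ}
    (h : IsSheetPair η μ U V G H) : Disjoint U V := by
  rw [Set.disjoint_left]
  intro Y h1 h2
  have h3 := h.left.re_pos Y h1
  have h4 := h.right.re_pos Y h2
  simp only [map_neg, neg_mul, Complex.neg_re] at h4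
  linarith

/-- The value of the superpotential along a gradient trajectory emanating from the critical
point `0` moves out on the ray `-1 + ζ ℝ≥0`, or the trajectory is constant. -/
lemma exists_W_eq_of_trajectory {ζ : ℂ} (hζ : ‖ζ‖ = 1) {Γ : ℝ → ℂ}
    (hΓ : IsIntegralCurveOn Γ (fun _ => gradField ζ) (Iic 0)) (hlim : Tendsto Γ atBot (𝓝 0))
    {x : ℝ} (hx : x ≤ 0) : ∃ s : ℝ, 0 ≤ s ∧ W (Γ x) = -1 + ζ * (s : ℂ) ^ 2 ∧ (s = 0 → Γ x = 0) := by
  set F : ℝ → ℂ := fun y => ζ⁻¹ * (W (Γ y) + 1) with hF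
  have hζ0 : ζ ≠ 0 := fun h => by simp [h] at hζ
  have hFd : ∀ y ∈ Iic (0 : ℝ),
      HasDerivWithinAt F ((Complex.normSq (1 - Complex.exp (Γ y)) : ℝ) : ℂ) (Iic 0) y := by
    intro y hy
    have h1 : HasDerivWithinAt Γ (gradField ζ (Γ y)) (Iic 0) y := hΓ y hy
    rw [gradField_apply hζ] at h1
    have h2 := (((hasDerivAt_W (Γ y)).comp_hasDerivWithinAt y h1).add_const 1).const_mul ζ⁻¹
    refine h2.congr_deriv ?_
    rw [← Complex.mul_conj]
    field_simp
  have hFlim : Tendsto F atBot (𝓝 0) := by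
    have h1 : Tendsto F atBot (𝓝 (ζ⁻¹ * (W 0 + 1))) :=
      (((continuous_W.tendsto 0).comp hlim).add_const 1).const_mul ζ⁻¹
    simpa using h1
  have hre : ∀ y ∈ Iic (0 : ℝ), HasDerivWithinAt (fun y => (F y).re)
      (Complex.normSq (1 - Complex.exp (Γ y))) (Iic 0) y := fun y hy =>
    Complex.reCLM.hasFDerivAt.comp_hasDerivWithinAt y (hFd y hy)
  have him : ∀ y ∈ Iic (0 : ℝ), HasDerivWithinAt (fun y => (F y).im) 0 (Iic 0) y := fun y hy =>
    (Complex.imCLM.hasFDerivAt.comp_hasDerivWithinAt y (hFd y hy)).congr_deriv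
      (by simp)
  have hmono : MonotoneOn (fun y => (F y).re) (Iic 0) := by
    refine monotoneOn_of_deriv_nonneg (convex_Iic 0)
      (fun y hy => (hre y hy).continuousWithinAt)
      (fun y hy => ((hre y (interior_subset hy)).mono interior_subset).differentiableWithinAt)
      fun y hy => ?_
    rw [((hre y (interior_subset hy)).hasDerivAt (mem_interior_iff_mem_nhds.1 hy)).deriv]
    exact Complex.normSq_nonneg _
  have him0 : ∀ y ∈ Iic (0 : ℝ), (F y).im = 0 := fun y hy =>
    eq_of_hasDerivWithinAt_zero (f := fun y => (F y).im)
      (fun z hz => (him z (Iic_subset_Iic.2 hy hz)).mono (Iic_subset_Iic.2 hy))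
      ((Complex.continuous_im.tendsto 0).comp hFlim)
  have hnonneg : ∀ y ∈ Iic (0 : ℝ), 0 ≤ (F y).re := fun y hy => by
    refine le_of_tendsto ((Complex.continuous_re.tendsto 0).comp hFlim) ?_
    filter_upwards [eventually_le_atBot y] with z hz using hmono (le_trans hz hy) hy hz
  refine ⟨√(F x).re, Real.sqrt_nonneg _, ?_, fun h0 => ?_⟩
  · have h1 : F x = ((F x).re : ℂ) := Complex.ext rfl (by simpa using him0 x hx)
    rw [← Complex.ofReal_pow, Real.sq_sqrt (hnonneg x hx), ← h1, hF]
    simp only [mul_inv_cancel_left₀ hζ0]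
    ring
  -- By monotonicity `F` vanishes at all earlier times, so `W' = 0` along the trajectory, which is
  -- therefore constant.
  · have hx0 : (F x).re = 0 := (Real.sqrt_eq_zero (hnonneg x hx)).1 h0
    refine eq_of_hasDerivWithinAt_zero (fun y hy => ?_) hlim
    have hy0 : y ∈ Iic (0 : ℝ) := le_trans hy hx
    have hsub : Iic x ⊆ Iic (0 : ℝ) := Iic_subset_Iic.2 hx
    have hzero : ∀ z ∈ Iic x, (F z).re = 0 := fun z hz =>
      le_antisymm (hx0 ▸ hmono (hsub hz) hx hz) (hnonneg z (hsub hz))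
    have h1 := (hre y hy0).mono hsub
    have h2 : HasDerivWithinAt (fun y => (F y).re) 0 (Iic x) y :=
      (hasDerivWithinAt_const y _ (0 : ℝ)).congr hzero (hzero y hy)
    have h3 : Complex.normSq (1 - Complex.exp (Γ y)) = 0 :=
      (uniqueDiffOn_Iic x y hy).eq_deriv _ h1 h2
    have h4 : HasDerivWithinAt Γ (gradField ζ (Γ y)) (Iic x) y := (hΓ y hy0).mono hsub
    rwa [gradField_apply hζ, Complex.normSq_eq_zero.1 h3, map_zero, mul_zero] at h4

namespace IsThimbleParam

variable {ζ σ : ℂ} {U V : Set ℂ} {γ : ℝ → ℂ}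

lemma exp_mul_deriv (h : IsThimbleParam ζ σ U V γ) (s : ℝ) :
    (1 - Complex.exp (γ s)) * deriv γ s = 2 * s * ζ := by
  have h1 := (hasDerivAt_W (γ s)).comp s
    ((h.contDiff.differentiable one_ne_zero).differentiableAt (x := s)).hasDerivAt
  have h2 : HasDerivAt (fun s : ℝ => -1 + ζ * (s : ℂ) ^ 2) (ζ * (2 * (s : ℂ))) s := by
    have h3 := ((Complex.ofRealCLM.hasDerivAt (x := s)).pow 2).const_mul ζ
    have h4 := h3.const_add (-1)
    simpa using h4
  have := h1.unique (h2.congr_of_eventuallyEq (Eventually.of_forall h.W_eq))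
  rw [this]
  ring

lemma deriv_ne_zero (h : IsThimbleParam ζ σ U V γ) (hζ : ζ ≠ 0) (hσ : σ ≠ 0) (s : ℝ) :
    deriv γ s ≠ 0 := by
  rcases eq_or_ne s 0 with rfl | hs
  · obtain ⟨c, hc, h'⟩ := h.deriv_zero
    rw [h']
    exact smul_ne_zero hc.ne' hσ
  · intro h0
    have h1 := h.exp_mul_deriv s
    rw [h0, mul_zero] at h1
    have : (s : ℂ) ≠ 0 := by exact_mod_cast hs
    exact mul_ne_zero (mul_ne_zero two_ne_zero this) hζ h1.symm

lemma comp_neg (h : IsThimbleParam ζ σ U V γ) :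
    IsThimbleParam ζ (-σ) V U (fun s => γ (-s)) where
  contDiff := h.contDiff.comp contDiff_neg
  W_eq s := by simpa using h.W_eq (-s)
  mem_of_pos s hs := h.mem_of_neg (-s) (neg_lt_zero.2 hs)
  mem_of_neg s hs := h.mem_of_pos (-s) (neg_pos.2 hs)
  map_zero := by simpa using h.map_zero
  deriv_zero := by
    obtain ⟨c, hc, h'⟩ := h.deriv_zero
    refine ⟨c, hc, ?_⟩
    rw [deriv_comp_neg, neg_zero, h', smul_neg]

lemma sq_eq_sq (h : IsThimbleParam ζ σ U V γ) (hζ : ζ ≠ 0) {s t : ℝ} (hst : W (γ s) = W (γ t)) :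
    s ^ 2 = t ^ 2 := by
  rw [h.W_eq, h.W_eq, add_right_inj, mul_right_inj' hζ] at hst
  exact_mod_cast hst

lemma injective (h : IsThimbleParam ζ σ U V γ) (hζ : ζ ≠ 0) (hUV : Disjoint U V) :
    Function.Injective γ := by
  intro s t hst
  have h1 : ∀ s t, 0 < s → t < 0 → γ s ≠ γ t := fun s t hs ht =>
    hUV.ne_of_mem (h.mem_of_pos s hs) (h.mem_of_neg t ht)
  rcases sq_eq_sq_iff_eq_or_eq_neg.1 (h.sq_eq_sq hζ (congrArg W hst)) with h2 | h2
  · exact h2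
  · rcases lt_trichotomy t 0 with ht | ht | ht
    · exact absurd hst (h1 s t (by linarith) ht)
    · rw [h2, ht, neg_zero]
    · exact absurd hst.symm (h1 t s ht (by linarith))

/-- `|W (γ s) + 1| = s²` makes `γ` proper, so it is a closed embedding once injective. -/
lemma isEmbedding (h : IsThimbleParam ζ σ U V γ) (hζ : ‖ζ‖ = 1) (hUV : Disjoint U V) :
    IsEmbedding γ := by
  have hζ0 : ζ ≠ 0 := fun h => by simp [h] at hζ
  refine (IsClosedEmbedding.of_continuous_injective_isClosedMap h.contDiff.continuous
    (h.injective hζ0 hUV) ?_).isEmbedding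
  refine (isProperMap_iff_tendsto_cocompact.2 ⟨h.contDiff.continuous, ?_⟩).isClosedMap
  rw [tendsto_def]
  intro S hS
  obtain ⟨K, hK, hKS⟩ := mem_cocompact.1 hS
  obtain ⟨R, hR⟩ := (hK.image continuous_W).isBounded.exists_norm_le
  refine mem_cocompact.2 ⟨Metric.closedBall 0 (R + 2), isCompact_closedBall _ _, fun s hs => hKS ?_⟩
  intro hsK
  apply hs
  have h1 := hR _ (mem_image_of_mem W hsK)
  rw [h.W_eq] at h1
  have h2 : ‖ζ * (s : ℂ) ^ 2‖ = s ^ 2 := by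
    rw [norm_mul, hζ, one_mul, norm_pow, Complex.norm_real, Real.norm_eq_abs, sq_abs]
  have h3 := norm_sub_le (-1 + ζ * (s : ℂ) ^ 2) (-1)
  rw [add_sub_cancel_left, h2, norm_neg, norm_one] at h3
  rw [mem_closedBall_zero_iff, Real.norm_eq_abs, abs_le]
  constructor <;> nlinarith

/-- A backward trajectory is connected, lies in `G ∪ H` and accumulates at `0 ∈ G`, so it never
leaves `G`. Its endpoint is then `0` or in one of the two sheets, where its value under `W`
determines it. -/
lemma range_eq {η : ℝ} {μ : ℂ} {G H : Set ℂ} (h : IsThimbleParam ζ σ U V γ)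
    (hζ : ‖ζ‖ = 1) (hσ : σ ≠ 0) (hη : 0 < η * ζ.re) (hp : IsSheetPair η μ U V G H) :
    range γ = L 0 ζ := by
  have hζ0 : ζ ≠ 0 := fun h => by simp [h] at hζ
  apply Subset.antisymm
  · rintro _ ⟨s, rfl⟩
    rcases lt_trichotomy s 0 with hs | rfl | hs
    · have := mem_L_of_deriv_eq hζ h.comp_neg.contDiff
        (h.comp_neg.deriv_ne_zero hζ0 (neg_ne_zero.2 hσ)) h.comp_neg.map_zero
        h.comp_neg.exp_mul_deriv (neg_pos.2 hs)
      simpa using this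
    · rw [h.map_zero]
      refine ⟨fun _ => 0, fun x _ => ?_, rfl, by simp⟩
      have : gradField ζ 0 = 0 := by simp [gradField_apply hζ]
      simpa [this] using hasDerivWithinAt_const x (Iic (0 : ℝ)) (0 : ℂ)
    · exact mem_L_of_deriv_eq hζ h.contDiff (h.deriv_ne_zero hζ0 hσ) h.map_zero
        h.exp_mul_deriv hs
  · rintro p ⟨Γ, hΓ, rfl, hlim⟩
    rw [crit_zero] at hlim
    have hW := fun x (hx : x ∈ Iic (0 : ℝ)) => exists_W_eq_of_trajectory hζ hΓ hlim hx
    have hcov : Γ '' Iic 0 ⊆ G ∪ H := by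
      rintro _ ⟨x, hx, rfl⟩
      obtain ⟨s, -, h2, h3⟩ := hW x hx
      rcases eq_or_ne s 0 with hs | hs
      · rw [h3 hs]; exact Or.inl hp.zero_mem
      · exact hp.cover _ (h2 ▸ ray_mem_halfPlane hη hs)
    have hG : Γ '' Iic 0 ⊆ G := by
      refine (isPreconnected_Iic.image Γ hΓ.continuousOn).subset_left_of_subset_union hp.isOpen_near
        hp.isOpen_far hp.disjoint hcov ?_
      obtain ⟨x, hx, hxG⟩ := ((eventually_le_atBot (0 : ℝ)).and
        (hlim.eventually_mem (hp.isOpen_near.mem_nhds hp.zero_mem))).exists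
      exact ⟨Γ x, ⟨x, hx, rfl⟩, hxG⟩
    obtain ⟨s, hs, h2, h3⟩ := hW 0 self_mem_Iic
    rcases hs.eq_or_lt with hs | hs
    · exact ⟨0, by rw [h.map_zero, h3 hs.symm]⟩
    · have h4 : W (Γ 0) ∈ halfPlane η := h2 ▸ ray_mem_halfPlane hη hs.ne'
      rcases hp.near _ h4 (hG ⟨0, self_mem_Iic, rfl⟩) with h5 | h5
      · exact ⟨s, hp.left.bijOn.injOn (h.mem_of_pos s hs) h5 ((h.W_eq s).trans h2.symm)⟩
      · refine ⟨-s, hp.right.bijOn.injOn (h.mem_of_neg _ (neg_lt_zero.2 hs)) h5 ?_⟩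
        rw [h.W_eq, h2]
        push_cast
        ring

/-- The translate of the parametrization to the critical point `Y_k`. -/
lemma isOrientedParam {η : ℝ} {μ : ℂ} {G H : Set ℂ} (h : IsThimbleParam ζ σ U V γ)
    (hζ : ‖ζ‖ = 1) (hσ : σ ≠ 0) (hη : 0 < η * ζ.re) (hp : IsSheetPair η μ U V G H) (k : ℤ) :
    IsOrientedParam (L k ζ) (crit k) σ (fun s => γ s + crit k) where
  contDiff := h.contDiff.add contDiff_const
  isEmbedding := (Homeomorph.addRight (crit k)).isEmbedding.comp (h.isEmbedding hζ hp.disjoint_sheets)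
  deriv_ne_zero s := by
    rw [deriv_add_const]
    exact h.deriv_ne_zero (fun h => by simp [h] at hζ) hσ s
  range_eq := by
    rw [L_eq_preimage hζ, ← h.range_eq hζ hσ hη hp]
    ext p
    simp only [mem_range, mem_ofPred_eq, eq_sub_iff_add_eq]
  map_zero := by rw [h.map_zero, zero_add]
  deriv_zero := by
    simpa only [deriv_add_const] using h.deriv_zero

end IsThimbleParam

/-! ### Orientations -/

lemma isPreconnected_halfCircle {η : ℝ} (hη : η ^ 2 = 1) :
    IsPreconnected {ζ : ℂ | ‖ζ‖ = 1 ∧ 0 < η * ζ.re} := by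
  have hη' : ((η : ℂ)) ^ 2 = 1 := by exact_mod_cast hη
  have habs : |η| = 1 := by rw [← sq_eq_sq₀ (abs_nonneg _) zero_le_one, sq_abs, hη, one_pow]
  have : {ζ : ℂ | ‖ζ‖ = 1 ∧ 0 < η * ζ.re} =
      (fun t : ℝ => (η : ℂ) * Complex.exp (t * Complex.I)) '' Ioo (-(Real.pi / 2)) (Real.pi / 2) := by
    ext ζ
    constructor
    · rintro ⟨h1, h2⟩
      have h3 : 0 < ((η : ℂ) * ζ).re := by rwa [Complex.re_ofReal_mul]
      have h4 := Complex.abs_arg_lt_pi_div_two_iff.2 (Or.inl h3)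
      refine ⟨((η : ℂ) * ζ).arg, abs_lt.1 h4, ?_⟩
      have h5 := Complex.norm_mul_exp_arg_mul_I ((η : ℂ) * ζ)
      rw [norm_mul, h1, Complex.norm_real, Real.norm_eq_abs, habs] at h5
      simp only [mul_one, Complex.ofReal_one, one_mul] at h5
      simp only [h5]
      linear_combination ζ * hη'
    · rintro ⟨t, ht, rfl⟩
      refine ⟨by rw [norm_mul, Complex.norm_exp_ofReal_mul_I, Complex.norm_real, Real.norm_eq_abs,
        habs, one_mul], ?_⟩
      rw [Complex.re_ofReal_mul, Complex.exp_ofReal_mul_I_re, ← mul_assoc, ← sq, hη, one_mul]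
      exact Real.cos_pos_of_mem_Ioo ht
  rw [this]
  exact isPreconnected_Ioo.image _ (by fun_prop)

lemma IsOrientation.neg {o : ℂ → ℂ} (ho : IsOrientation o) : IsOrientation fun ζ => -o ζ :=
  ⟨ho.1.neg, fun ζ h1 h2 => by rw [neg_sq, ho.2 ζ h1 h2]⟩

/-- `(conj μ · o ζ)² = η ζ` has positive real part, so `conj μ · o ζ` is never purely imaginary, and
its real part keeps its sign on the connected half-circle. -/
lemma IsOrientation.re_mul_re_pos {o : ℂ → ℂ} (ho : IsOrientation o) {η : ℝ} (hη : η ^ 2 = 1)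
    {μ : ℂ} (hμ : conj μ ^ 2 = -η) {a b : ℂ} (ha : ‖a‖ = 1) (ha' : 0 < η * a.re)
    (hb : ‖b‖ = 1) (hb' : 0 < η * b.re) : 0 < (conj μ * o a).re * (conj μ * o b).re := by
  set S := {ζ : ℂ | ‖ζ‖ = 1 ∧ 0 < η * ζ.re}
  set q : ℂ → ℝ := fun ζ => (conj μ * o ζ).re with hq
  have hS : ∀ ζ ∈ S, ζ.re ≠ 0 := fun ζ hζ h => by
    have := hζ.2
    simp [h] at this
  have hqc : ContinuousOn q S :=
    Complex.continuous_re.comp_continuousOn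
      (continuousOn_const.mul (ho.1.mono fun ζ hζ => ⟨hζ.1, hS ζ hζ⟩))
  have hq0 : ∀ ζ ∈ S, q ζ ≠ 0 := fun ζ hζ h => by
    have h1 : (conj μ * o ζ) ^ 2 = (η : ℂ) * ζ := by
      rw [mul_pow, hμ, ho.2 ζ hζ.1 (hS ζ hζ)]; ring
    have h2 : ((conj μ * o ζ) ^ 2).re = η * ζ.re := by rw [h1, Complex.re_ofReal_mul]
    rw [sq, Complex.mul_re, show (conj μ * o ζ).re = 0 from h] at h2
    have := hζ.2
    nlinarith [sq_nonneg (conj μ * o ζ).im]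
  have key : ∀ a ∈ S, ∀ b ∈ S, q a < 0 → 0 < q b → False := fun a ha b hb h1 h2 => by
    obtain ⟨c, hc, h3⟩ := (isPreconnected_halfCircle hη).intermediate_value ha hb hqc ⟨h1.le, h2.le⟩
    exact hq0 c hc h3
  have haS : a ∈ S := ⟨ha, ha'⟩
  have hbS : b ∈ S := ⟨hb, hb'⟩
  rcases lt_or_gt_of_ne (hq0 a haS) with h1 | h1 <;> rcases lt_or_gt_of_ne (hq0 b hbS) with h2 | h2
  · exact mul_pos_of_neg_of_neg h1 h2
  · exact (key a haS b hbS h1 h2).elim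
  · exact (key b hbS a haS h2 h1).elim
  · exact mul_pos h1 h2

lemma IsOrientedParam.comp_neg {C : Set ℂ} {q v : ℂ} {γ : ℝ → ℂ} (h : IsOrientedParam C q v γ) :
    IsOrientedParam C q (-v) (fun s => γ (-s)) where
  contDiff := h.contDiff.comp contDiff_neg
  isEmbedding := h.isEmbedding.comp (Homeomorph.neg ℝ).isEmbedding
  deriv_ne_zero s := by
    rw [deriv_comp_neg]
    exact neg_ne_zero.2 (h.deriv_ne_zero _)
  range_eq := by
    rw [← h.range_eq]
    exact (Equiv.neg ℝ).surjective.range_comp γ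
  map_zero := by rw [neg_zero, h.map_zero]
  deriv_zero := by
    obtain ⟨c, hc, h'⟩ := h.deriv_zero
    exact ⟨c, hc, by rw [deriv_comp_neg, neg_zero, h', smul_neg]⟩

lemma MeetsOnceAt.of_neg {o : ℂ → ℂ} {k l : ℤ} {ζ ζ' p : ℂ} {ε : SignType}
    (h : MeetsOnceAt (fun z => -o z) k ζ l ζ' p ε) : MeetsOnceAt o k ζ l ζ' p ε := by
  obtain ⟨h1, γ, δ, s, t, hγ, hδ, hs, ht, h2, h3⟩ := h
  refine ⟨h1, fun s => γ (-s), fun s => δ (-s), -s, -t, by simpa using hγ.comp_neg,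
    by simpa using hδ.comp_neg, by simpa, by simpa, ?_⟩
  simpa [deriv_comp_neg] using And.intro h2 h3

/-! ### Intersections -/

/-- Two phases `η e^{-iθ'}` and `η e^{iθ}` and parametrizations of the corresponding thimbles
at the critical point `0`. -/
structure IsCrossing (η θ θ' : ℝ) (μ : ℂ) (U V G H : Set ℂ) (ζ' ζ σ' σ : ℂ) (γ δ : ℝ → ℂ) :
    Prop where
  sq_eq_one : η ^ 2 = 1
  mem : θ ∈ Ioo 0 (Real.pi / 2)
  mem' : θ' ∈ Ioo 0 (Real.pi / 2)
  pair : IsSheetPair η μ U V G H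
  conj_sq : conj μ ^ 2 = -η
  phase' : ζ' = η * Complex.exp (-(θ' * Complex.I))
  phase : ζ = η * Complex.exp (θ * Complex.I)
  dir_sq' : σ' ^ 2 = -ζ'
  dir_sq : σ ^ 2 = -ζ
  re_pos' : 0 < (conj μ * σ').re
  re_pos : 0 < (conj μ * σ).re
  param' : IsThimbleParam ζ' σ' U V γ
  param : IsThimbleParam ζ σ U V δ

section phases

variable {η θ : ℝ} {ζ : ℂ}

lemma phase_re (h : ζ = η * Complex.exp (θ * Complex.I)) : ζ.re = η * Real.cos θ := by
  rw [h, Complex.re_ofReal_mul, Complex.exp_ofReal_mul_I_re]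

lemma phase_im (h : ζ = η * Complex.exp (θ * Complex.I)) : ζ.im = η * Real.sin θ := by
  rw [h, Complex.im_ofReal_mul, Complex.exp_ofReal_mul_I_im]

lemma norm_phase (hη : η ^ 2 = 1) (h : ζ = η * Complex.exp (θ * Complex.I)) : ‖ζ‖ = 1 := by
  rw [h, norm_mul, Complex.norm_exp_ofReal_mul_I, mul_one, Complex.norm_real, Real.norm_eq_abs,
    ← sq_eq_sq₀ (abs_nonneg _) zero_le_one, sq_abs, hη, one_pow]

lemma mul_phase_re_pos (hη : η ^ 2 = 1) (hθ : θ ∈ Ioo (-(Real.pi / 2)) (Real.pi / 2))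
    (h : ζ = η * Complex.exp (θ * Complex.I)) : 0 < η * ζ.re := by
  rw [phase_re h, ← mul_assoc, ← sq, hη, one_mul]
  exact Real.cos_pos_of_mem_Ioo hθ

end phases

namespace IsCrossing

variable {η θ θ' : ℝ} {μ ζ' ζ σ' σ : ℂ} {U V G H : Set ℂ} {γ δ : ℝ → ℂ}

lemma phase_neg (h : IsCrossing η θ θ' μ U V G H ζ' ζ σ' σ γ δ) :
    ζ' = η * Complex.exp ((-θ' : ℝ) * Complex.I) := by
  rw [h.phase']; push_cast; ring_nf

lemma norm_eq (h : IsCrossing η θ θ' μ U V G H ζ' ζ σ' σ γ δ) : ‖ζ‖ = 1 :=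
  norm_phase h.sq_eq_one h.phase

lemma norm_eq' (h : IsCrossing η θ θ' μ U V G H ζ' ζ σ' σ γ δ) : ‖ζ'‖ = 1 :=
  norm_phase h.sq_eq_one h.phase_neg

lemma mul_re_pos (h : IsCrossing η θ θ' μ U V G H ζ' ζ σ' σ γ δ) : 0 < η * ζ.re :=
  mul_phase_re_pos h.sq_eq_one ⟨by linarith [h.mem.1, h.mem.2], h.mem.2⟩ h.phase

lemma mul_re_pos' (h : IsCrossing η θ θ' μ U V G H ζ' ζ σ' σ γ δ) : 0 < η * ζ'.re :=
  mul_phase_re_pos h.sq_eq_one ⟨by linarith [h.mem'.2], by linarith [h.mem'.1, h.mem'.2]⟩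
    h.phase_neg

lemma dir_ne_zero (h : IsCrossing η θ θ' μ U V G H ζ' ζ σ' σ γ δ) : σ ≠ 0 := fun h0 => by
  have := h.re_pos
  simp [h0] at this

lemma dir_ne_zero' (h : IsCrossing η θ θ' μ U V G H ζ' ζ σ' σ γ δ) : σ' ≠ 0 := fun h0 => by
  have := h.re_pos'
  simp [h0] at this

lemma sin_add_pos (h : IsCrossing η θ θ' μ U V G H ζ' ζ σ' σ γ δ) : 0 < Real.sin (θ + θ') :=
  Real.sin_pos_of_pos_of_lt_pi (by linarith [h.mem.1, h.mem'.1]) (by linarith [h.mem.2, h.mem'.2])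

lemma cos_pos (h : IsCrossing η θ θ' μ U V G H ζ' ζ σ' σ γ δ) : 0 < Real.cos θ :=
  Real.cos_pos_of_mem_Ioo ⟨by linarith [h.mem.1, h.mem.2], h.mem.2⟩

lemma cos_pos' (h : IsCrossing η θ θ' μ U V G H ζ' ζ σ' σ γ δ) : 0 < Real.cos θ' :=
  Real.cos_pos_of_mem_Ioo ⟨by linarith [h.mem'.1, h.mem'.2], h.mem'.2⟩

lemma isOrientedParam (h : IsCrossing η θ θ' μ U V G H ζ' ζ σ' σ γ δ) (l : ℤ) :
    IsOrientedParam (L l ζ) (crit l) σ (fun s => δ s + crit l) :=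
  h.param.isOrientedParam h.norm_eq h.dir_ne_zero h.mul_re_pos h.pair l

lemma isOrientedParam' (h : IsCrossing η θ θ' μ U V G H ζ' ζ σ' σ γ δ) (k : ℤ) :
    IsOrientedParam (L k ζ') (crit k) σ' (fun s => γ s + crit k) :=
  h.param'.isOrientedParam h.norm_eq' h.dir_ne_zero' h.mul_re_pos' h.pair k

/-- The values of `W` at two points of the thimbles agree if and only if the parameters have
the squares determined by the intersection of the two rays. -/
lemma W_eq_iff (h : IsCrossing η θ θ' μ U V G H ζ' ζ σ' σ γ δ) {k l : ℤ} {s t : ℝ} :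
    W (γ s + crit k) = W (δ t + crit l) ↔
      s ^ 2 * Real.sin (θ + θ') = 2 * Real.pi * (η * (k - l)) * Real.cos θ ∧
      t ^ 2 * Real.sin (θ + θ') = 2 * Real.pi * (η * (k - l)) * Real.cos θ' := by
  have hη := h.sq_eq_one
  have hη0 : η ≠ 0 := fun h0 => by simp [h0] at hη
  have hs : (ζ' * (s : ℂ) ^ 2).re = η * Real.cos θ' * s ^ 2 ∧
      (ζ' * (s : ℂ) ^ 2).im = -(η * Real.sin θ' * s ^ 2) := by
    rw [← Complex.ofReal_pow, Complex.re_mul_ofReal, Complex.im_mul_ofReal, phase_re h.phase_neg,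
      phase_im h.phase_neg, Real.cos_neg, Real.sin_neg]
    exact ⟨rfl, by ring⟩
  have ht : (ζ * (t : ℂ) ^ 2).re = η * Real.cos θ * t ^ 2 ∧
      (ζ * (t : ℂ) ^ 2).im = η * Real.sin θ * t ^ 2 := by
    rw [← Complex.ofReal_pow, Complex.re_mul_ofReal, Complex.im_mul_ofReal, phase_re h.phase,
      phase_im h.phase]
    exact ⟨rfl, rfl⟩
  -- Real and imaginary parts give a linear system in `s²`, `t²` with determinant `sin (θ + θ')`.
  have e1 : W (γ s + crit k) = W (δ t + crit l) ↔
      Real.cos θ' * s ^ 2 = Real.cos θ * t ^ 2 ∧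
      Real.sin θ' * s ^ 2 + Real.sin θ * t ^ 2 = 2 * Real.pi * (η * (k - l)) := by
    rw [W_add_crit, W_add_crit, h.param'.W_eq, h.param.W_eq, Complex.ext_iff]
    simp only [Complex.add_re, Complex.add_im, crit_re, crit_im, hs.1, hs.2, ht.1, ht.2]
    constructor
    · rintro ⟨h1, h2⟩
      refine ⟨mul_left_cancel₀ hη0 (by linarith), mul_left_cancel₀ hη0 ?_⟩
      linear_combination -h2 - 2 * Real.pi * (k - l) * hη
    · rintro ⟨h1, h2⟩
      constructor
      · linear_combination η * h1
      · linear_combination -η * h2 - 2 * Real.pi * (k - l) * hη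
  have hsin := h.sin_add_pos
  have hcos := h.cos_pos
  rw [e1, Real.sin_add]
  rw [Real.sin_add] at hsin
  constructor
  · rintro ⟨h1, h2⟩
    constructor
    · linear_combination Real.sin θ * h1 + Real.cos θ * h2
    · linear_combination Real.cos θ' * h2 - Real.sin θ' * h1
  · rintro ⟨h1, h2⟩
    constructor <;> refine mul_right_cancel₀ hsin.ne' ?_
    · linear_combination Real.cos θ' * h1 - Real.cos θ * h2
    · linear_combination Real.sin θ' * h1 + Real.sin θ * h2

lemma mem_inter_iff (h : IsCrossing η θ θ' μ U V G H ζ' ζ σ' σ γ δ) {k l : ℤ} {p : ℂ} :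
    p ∈ L k ζ' ∩ L l ζ ↔ ∃ s t : ℝ, γ s + crit k = p ∧ δ t + crit l = p := by
  rw [← (h.isOrientedParam l).range_eq, ← (h.isOrientedParam' k).range_eq]
  exact exists_and_exists_comm

lemma nonneg_of_eq (h : IsCrossing η θ θ' μ U V G H ζ' ζ σ' σ γ δ) {k l : ℤ} {s t : ℝ}
    (hst : γ s + crit k = δ t + crit l) : 0 ≤ η * (k - l) := by
  have h1 := (h.W_eq_iff.1 (congrArg W hst)).1
  by_contra! hneg
  have h2 : 2 * Real.pi * (η * (k - l)) * Real.cos θ < 0 :=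
    mul_neg_of_neg_of_pos (mul_neg_of_pos_of_neg Real.two_pi_pos hneg) h.cos_pos
  have h3 := mul_nonneg (sq_nonneg s) h.sin_add_pos.le
  linarith

lemma ne_zero_of_eq (h : IsCrossing η θ θ' μ U V G H ζ' ζ σ' σ γ δ) {k l : ℤ} (hkl : k ≠ l)
    {s t : ℝ} (hst : γ s + crit k = δ t + crit l) : s ≠ 0 ∧ t ≠ 0 := by
  have hη0 : η ≠ 0 := fun h0 => by simpa [h0] using h.sq_eq_one
  have hkl' : (k : ℝ) - l ≠ 0 := sub_ne_zero.2 (by exact_mod_cast hkl)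
  obtain ⟨h1, h2⟩ := h.W_eq_iff.1 (congrArg W hst)
  have h3 : 2 * Real.pi * (η * (k - l)) ≠ 0 :=
    mul_ne_zero Real.two_pi_pos.ne' (mul_ne_zero hη0 hkl')
  constructor
  · rintro rfl
    rw [zero_pow two_ne_zero, zero_mul] at h1
    exact mul_ne_zero h3 h.cos_pos.ne' h1.symm
  · rintro rfl
    rw [zero_pow two_ne_zero, zero_mul] at h2
    exact mul_ne_zero h3 h.cos_pos'.ne' h2.symm

/-- Rotated by `conj μ`, the directions become square roots of `e^{-iθ'}` and `e^{iθ}` with positive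
real part, hence lie in the fourth and first quadrants: a positive basis. -/
lemma meetsOnceAt_self (h : IsCrossing η θ θ' μ U V G H ζ' ζ σ' σ γ δ) {o : ℂ → ℂ}
    (ho' : o ζ' = σ') (ho : o ζ = σ) (k : ℤ) : MeetsOnceAt o k ζ' k ζ (crit k) 1 := by
  refine ⟨?_, fun s => γ s + crit k, fun s => δ s + crit k, 0, 0,
    ho' ▸ h.isOrientedParam' k, ho ▸ h.isOrientedParam k, by simp [h.param'.map_zero],
    by simp [h.param.map_zero], ?_⟩
  · ext p
    rw [h.mem_inter_iff, mem_singleton_iff]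
    constructor
    · rintro ⟨s, t, rfl, hst⟩
      have h1 := (h.W_eq_iff.1 (congrArg W hst.symm)).1
      rw [sub_self, mul_zero, mul_zero, zero_mul, mul_eq_zero,
        or_iff_left h.sin_add_pos.ne', sq_eq_zero_iff] at h1
      rw [h1, h.param'.map_zero, zero_add]
    · rintro rfl
      exact ⟨0, 0, by rw [h.param'.map_zero, zero_add], by rw [h.param.map_zero, zero_add]⟩
  · obtain ⟨c, hc, hγ⟩ := h.param'.deriv_zero
    obtain ⟨d, hd, hδ⟩ := h.param.deriv_zero
    simp only [deriv_add_const, hγ, hδ, Complex.smul_re, Complex.smul_im, smul_eq_mul]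
    have hsq : ∀ {τ z : ℂ} {φ : ℝ}, τ ^ 2 = -z → z = η * Complex.exp (φ * Complex.I) →
        2 * ((conj μ * τ).re * (conj μ * τ).im) = Real.sin φ := fun {τ z φ} h1 h2 => by
      have h3 : (conj μ * τ) ^ 2 = (η : ℂ) * z := by rw [mul_pow, h1, h.conj_sq]; ring
      have h4 := congrArg Complex.im h3
      rw [Complex.im_ofReal_mul, phase_im h2, ← mul_assoc, ← sq, h.sq_eq_one, one_mul, sq,
        Complex.mul_im] at h4
      linarith
    have h1 := hsq h.dir_sq' h.phase_neg
    have h2 := hsq h.dir_sq h.phase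
    have hs' : 0 < Real.sin θ' :=
      Real.sin_pos_of_pos_of_lt_pi h.mem'.1 (by linarith [h.mem'.2, Real.pi_pos])
    have hs : 0 < Real.sin θ :=
      Real.sin_pos_of_pos_of_lt_pi h.mem.1 (by linarith [h.mem.2, Real.pi_pos])
    rw [Real.sin_neg] at h1
    have h3 : (conj μ * σ').im < 0 := by
      by_contra! h0
      linarith [mul_nonneg h.re_pos'.le h0]
    have h4 : 0 < (conj μ * σ).im := by
      by_contra! h0
      linarith [mul_nonpos_of_nonneg_of_nonpos h.re_pos.le h0]
    have hμ : Complex.normSq μ * (σ'.re * σ.im - σ'.im * σ.re) =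
        (conj μ * σ').re * (conj μ * σ).im - (conj μ * σ').im * (conj μ * σ).re := by
      simp only [Complex.mul_re, Complex.mul_im, Complex.conj_re, Complex.conj_im,
        Complex.normSq_apply]
      ring
    have h5 : 0 < Complex.normSq μ * (σ'.re * σ.im - σ'.im * σ.re) := by
      rw [hμ]
      linarith [mul_pos h.re_pos' h4, mul_neg_of_neg_of_pos h3 h.re_pos]
    have h6 := pos_of_mul_pos_right h5 (Complex.normSq_nonneg μ)
    have h7 : 0 < c * σ'.re * (d * σ.im) - c * σ'.im * (d * σ.re) := by
      have := mul_pos (mul_pos hc hd) h6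
      linarith
    exact ⟨h7.ne', sign_pos h7⟩

/-- The rays fix `s²`, so `huniq` only has to fix the sign of `s`. Multiplying both velocities by
the common value of `W'` turns them into `2sζ'` and `2tζ`, without changing the sign of the
determinant. -/
lemma meetsOnceAt_of_eq (h : IsCrossing η θ θ' μ U V G H ζ' ζ σ' σ γ δ) {o : ℂ → ℂ}
    (ho' : o ζ' = σ') (ho : o ζ = σ) {k l : ℤ} (hkl : k ≠ l) {s t : ℝ}
    (hst : γ s + crit k = δ t + crit l)
    (huniq : ∀ s' t', γ s' + crit k = δ t' + crit l → 0 < s * s') :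
    MeetsOnceAt o k ζ' l ζ (γ s + crit k) (SignType.sign (s * t)) := by
  refine ⟨?_, fun s => γ s + crit k, fun s => δ s + crit l, s, t,
    ho' ▸ h.isOrientedParam' k, ho ▸ h.isOrientedParam l, rfl, hst.symm, ?_⟩
  · ext p
    rw [h.mem_inter_iff, mem_singleton_iff]
    constructor
    · rintro ⟨s', t', rfl, hst'⟩
      have h1 := (h.W_eq_iff.1 (congrArg W hst)).1
      have h2 := (h.W_eq_iff.1 (congrArg W hst'.symm)).1
      have h3 : s' ^ 2 = s ^ 2 := mul_right_cancel₀ h.sin_add_pos.ne' (h2.trans h1.symm)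
      rcases sq_eq_sq_iff_eq_or_eq_neg.1 h3 with rfl | rfl
      · rfl
      · have := huniq _ _ hst'.symm
        nlinarith [sq_nonneg s]
    · rintro rfl
      exact ⟨s, t, rfl, hst.symm⟩
  · simp only [deriv_add_const]
    obtain ⟨hs0, ht0⟩ := h.ne_zero_of_eq hkl hst
    have h1 := h.param'.exp_mul_deriv s
    have h2 := h.param.exp_mul_deriv t
    rw [← exp_add_crit _ k] at h1
    rw [← exp_add_crit _ l, ← hst] at h2
    set w := 1 - Complex.exp (γ s + crit k)
    have hζ' : ζ' ≠ 0 := fun h0 => by simpa [h0] using h.norm_eq'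
    have hw : w ≠ 0 := fun h0 => by
      rw [h0, zero_mul] at h1
      have : (s : ℂ) ≠ 0 := by exact_mod_cast hs0
      exact mul_ne_zero (mul_ne_zero two_ne_zero this) hζ' h1.symm
    have hw' : 0 < Complex.normSq w := Complex.normSq_pos.2 hw
    have h3 : ∀ a b : ℂ, Complex.normSq w * (a.re * b.im - a.im * b.re) =
        (w * a).re * (w * b).im - (w * a).im * (w * b).re := fun a b => by
      simp only [Complex.mul_re, Complex.mul_im, Complex.normSq_apply]
      ring
    have h4 : ∀ (r : ℝ) (z : ℂ), (2 * (r : ℂ) * z).re = 2 * r * z.re ∧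
        (2 * (r : ℂ) * z).im = 2 * r * z.im := fun r z => by
      constructor <;> simp
    have h5 := h3 (deriv γ s) (deriv δ t)
    rw [h1, h2, (h4 s ζ').1, (h4 s ζ').2, (h4 t ζ).1, (h4 t ζ).2, phase_re h.phase_neg,
      phase_im h.phase_neg, phase_re h.phase, phase_im h.phase, Real.cos_neg, Real.sin_neg] at h5
    set D := (deriv γ s).re * (deriv δ t).im - (deriv γ s).im * (deriv δ t).re
    have h6 : Complex.normSq w * D = 4 * Real.sin (θ + θ') * (s * t) := by
      rw [h5, Real.sin_add]
      linear_combination 4 * s * t * (Real.sin θ * Real.cos θ' + Real.cos θ * Real.sin θ') *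
        h.sq_eq_one
    have h7 : SignType.sign D = SignType.sign (s * t) := by
      have := congrArg SignType.sign h6
      rwa [sign_mul, sign_mul, sign_pos hw', sign_pos (mul_pos four_pos h.sin_add_pos), one_mul,
        one_mul] at this
    refine ⟨fun h0 => ?_, h7⟩
    rw [h0, sign_zero, eq_comm, sign_eq_zero_iff] at h7
    exact mul_ne_zero hs0 ht0 h7

/-- Parameters at which the values of `W` on the two thimbles agree. -/
lemma exists_pos_W_eq (h : IsCrossing η θ θ' μ U V G H ζ' ζ σ' σ γ δ) {k l : ℤ}
    (hkl : 0 < η * (k - l)) : ∃ s t : ℝ, 0 < s ∧ 0 < t ∧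
      ∀ s' t' : ℝ, s' ^ 2 = s ^ 2 → t' ^ 2 = t ^ 2 → W (γ s' + crit k) = W (δ t' + crit l) := by
  have h0 := h.sin_add_pos
  have h1 := h.cos_pos
  have h2 := h.cos_pos'
  have hpi := Real.pi_pos
  have hs : 0 < 2 * Real.pi * (η * (k - l)) * Real.cos θ / Real.sin (θ + θ') := by positivity
  have ht : 0 < 2 * Real.pi * (η * (k - l)) * Real.cos θ' / Real.sin (θ + θ') := by positivity
  refine ⟨_, _, Real.sqrt_pos.2 hs, Real.sqrt_pos.2 ht, fun s' t' e1 e2 => ?_⟩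
  rw [Real.sq_sqrt hs.le] at e1
  rw [Real.sq_sqrt ht.le] at e2
  rw [h.W_eq_iff, e1, e2]
  exact ⟨div_mul_cancel₀ _ h0.ne', div_mul_cancel₀ _ h0.ne'⟩

end IsCrossing

/-- After a simultaneous change of all orientations, the oriented thimbles of the two phases are
parametrized compatibly with a given pair of sheets. -/
lemma IsOrientation.exists_isCrossing {o : ℂ → ℂ} (ho : IsOrientation o) {η θ θ' : ℝ}
    (hη : η ^ 2 = 1) (hθ : θ ∈ Ioo 0 (Real.pi / 2)) (hθ' : θ' ∈ Ioo 0 (Real.pi / 2))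
    {μ ζ' ζ : ℂ} {U V G H : Set ℂ} (hp : IsSheetPair η μ U V G H) (hμ : conj μ ^ 2 = -η)
    (hζ' : ζ' = η * Complex.exp (-(θ' * Complex.I))) (hζ : ζ = η * Complex.exp (θ * Complex.I)) :
    ∃ (o' : ℂ → ℂ) (γ δ : ℝ → ℂ), IsCrossing η θ θ' μ U V G H ζ' ζ (o' ζ') (o' ζ) γ δ ∧
      ∀ k l p ε, MeetsOnceAt o' k ζ' l ζ p ε → MeetsOnceAt o k ζ' l ζ p ε := by
  have hζn : ζ' = η * Complex.exp ((-θ' : ℝ) * Complex.I) := by rw [hζ']; push_cast; ring_nf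
  have hpos := mul_phase_re_pos hη ⟨by linarith [hθ.1, hθ.2], hθ.2⟩ hζ
  have hpos' := mul_phase_re_pos hη ⟨by linarith [hθ'.2], by linarith [hθ'.1, hθ'.2]⟩ hζn
  have hn := norm_phase hη hζ
  have hn' := norm_phase hη hζn
  have hre : ζ.re ≠ 0 := fun h0 => by simp [h0] at hpos
  have hre' : ζ'.re ≠ 0 := fun h0 => by simp [h0] at hpos'
  have key : ∀ o' : ℂ → ℂ, IsOrientation o' → 0 < (conj μ * o' ζ').re → 0 < (conj μ * o' ζ).re →
      ∃ γ δ, IsCrossing η θ θ' μ U V G H ζ' ζ (o' ζ') (o' ζ) γ δ := fun o' ho' h1 h2 => by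
    obtain ⟨γ, hγ⟩ := hp.exists_isThimbleParam hpos' (ho'.2 ζ' hn' hre') h1
    obtain ⟨δ, hδ⟩ := hp.exists_isThimbleParam hpos (ho'.2 ζ hn hre) h2
    exact ⟨γ, δ, hη, hθ, hθ', hp, hμ, hζ', hζ, ho'.2 ζ' hn' hre', ho'.2 ζ hn hre, h1, h2, hγ, hδ⟩
  rcases pos_and_pos_or_neg_and_neg_of_mul_pos (ho.re_mul_re_pos hη hμ hn' hpos' hn hpos) with
    ⟨h1, h2⟩ | ⟨h1, h2⟩
  · obtain ⟨γ, δ, h⟩ := key o ho h1 h2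
    exact ⟨o, γ, δ, h, fun k l p ε h => h⟩
  · obtain ⟨γ, δ, h⟩ := key (fun z => -o z) ho.neg (by simpa only [mul_neg, Complex.neg_re, neg_pos] using h1)
      (by simpa only [mul_neg, Complex.neg_re, neg_pos] using h2)
    exact ⟨_, γ, δ, h, fun k l p ε h => h.of_neg⟩

/-! ### The two families of intersections -/

lemma not_mem_right_sheets {Y Z : ℂ} (hY : Y ∈ rightSheet) (hZ : Z ∈ rightSheet) {k l : ℤ}
    (hkl : k ≠ l) : Y + crit k ≠ Z + crit l := by
  intro h
  have h1 := congrArg Complex.im h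
  simp only [Complex.add_im, crit_im] at h1
  obtain ⟨h2, h3⟩ := abs_lt.1 hY.1.1
  obtain ⟨h4, h5⟩ := abs_lt.1 hZ.1.1
  have hpi := Real.pi_pos
  have h6 : ((k - l : ℤ) : ℝ) < 1 := by push_cast; nlinarith
  have h7 : (-1 : ℝ) < (k - l : ℤ) := by push_cast; nlinarith
  norm_cast at h6 h7
  omega

lemma add_crit_mem_leftSheet {Y : ℂ} (hY : Y ∈ leftSheet) (k : ℤ) : Y + crit k ∈ leftSheet := by
  rwa [← mem_leftSheet_sub_crit (k := k), add_sub_cancel_right]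

lemma add_crit_mem_stripSheet {Y : ℂ} {m : ℤ} (hY : Y ∈ stripSheet m) (k : ℤ) :
    Y + crit k ∈ stripSheet (m + k) := by
  rwa [← mem_stripSheet_sub_crit, add_sub_cancel_right]

lemma right_ne_left {Y Z : ℂ} (hY : Y ∈ rightSheet) (hZ : Z ∈ leftSheet) (k l : ℤ) :
    Y + crit k ≠ Z + crit l := by
  intro h
  have h1 := isSheet_rightSheet.re_pos Y hY
  have h2 := isSheet_leftSheet.re_pos Z hZ
  have h3 := congrArg Complex.re h
  simp at h1 h2 h3
  linarith

lemma eq_of_mem_stripSheet {Y : ℂ} {m n : ℤ} (hm : Y ∈ stripSheet m) (hn : Y ∈ stripSheet n) :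
    m = n := by
  obtain ⟨h1, h2⟩ := hm.1
  obtain ⟨h3, h4⟩ := hn.1
  have hpi := Real.two_pi_pos
  have h5 : (m : ℝ) < n + 1 := lt_of_mul_lt_mul_left (h1.trans h4) hpi.le
  have h6 : (n : ℝ) < m + 1 := lt_of_mul_lt_mul_left (h3.trans h2) hpi.le
  norm_cast at h5 h6
  omega

lemma injOn_stripSheet (m : ℤ) : InjOn W (stripSheet m) := by
  intro a ha b hb hab
  have h := isSheet_stripSheet_zero.bijOn.injOn
    (mem_stripSheet_sub_crit (k := m).2 ((zero_add m).symm ▸ ha))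
    (mem_stripSheet_sub_crit (k := m).2 ((zero_add m).symm ▸ hb)) (by rw [W_sub_crit, W_sub_crit, hab])
  exact sub_left_injective h

lemma intersections_left {θ θ' : ℝ} (hθ : θ ∈ Ioo 0 (Real.pi / 2))
    (hθ' : θ' ∈ Ioo 0 (Real.pi / 2)) {o : ℂ → ℂ} (ho : IsOrientation o) (k l : ℤ) :
    (k ≤ l → ∃ p : ℂ, MeetsOnceAt o k (-Complex.exp (-(θ' * Complex.I)))
        l (-Complex.exp (θ * Complex.I)) p 1) ∧
    (¬ k ≤ l → L k (-Complex.exp (-(θ' * Complex.I))) ∩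
        L l (-Complex.exp (θ * Complex.I)) = ∅) := by
  obtain ⟨o', γ, δ, h, hmeet⟩ := ho.exists_isCrossing (η := -1) (by norm_num) hθ hθ'
    isSheetPair_left_right (by simp) (by simp : -Complex.exp (-(θ' * Complex.I)) = _)
    (by simp : -Complex.exp (θ * Complex.I) = _)
  refine ⟨fun hkl => ?_, fun hkl => ?_⟩
  · rcases hkl.eq_or_lt with rfl | hkl
    · exact ⟨_, hmeet _ _ _ _ (h.meetsOnceAt_self rfl rfl k)⟩
    · obtain ⟨s, t, hs, ht, hW⟩ := h.exists_pos_W_eq (k := k) (l := l) (by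
        have : (k : ℝ) < l := by exact_mod_cast hkl
        linarith)
      -- Both negative branches lie in the translation-invariant left sheet, so equal values of `W`
      -- force equal points.
      have heq : γ (-s) + crit k = δ (-t) + crit l :=
        isSheet_leftSheet.bijOn.injOn
          (add_crit_mem_leftSheet (h.param'.mem_of_neg _ (neg_lt_zero.2 hs)) k)
          (add_crit_mem_leftSheet (h.param.mem_of_neg _ (neg_lt_zero.2 ht)) l)
          (hW _ _ (neg_sq s) (neg_sq t))
      have hm := h.meetsOnceAt_of_eq rfl rfl hkl.ne heq fun s' t' hst => by
        obtain ⟨hs', ht'⟩ := h.ne_zero_of_eq hkl.ne hst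
        refine mul_pos_of_neg_of_neg (neg_lt_zero.2 hs) (lt_of_le_of_ne (not_lt.1 fun h0 => ?_) hs')
        have h1 := h.param'.mem_of_pos s' h0
        rcases lt_or_gt_of_ne ht' with h2 | h2
        · exact right_ne_left h1 (h.param.mem_of_neg t' h2) k l hst
        · exact not_mem_right_sheets h1 (h.param.mem_of_pos t' h2) hkl.ne hst
      rw [neg_mul_neg, sign_pos (mul_pos hs ht)] at hm
      exact ⟨_, hmeet _ _ _ _ hm⟩
  · rw [eq_empty_iff_forall_notMem]
    rintro p hp
    obtain ⟨s, t, rfl, hst⟩ := h.mem_inter_iff.1 hp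
    have h1 := h.nonneg_of_eq hst.symm
    have : (l : ℝ) < k := by exact_mod_cast not_le.1 hkl
    linarith

lemma intersections_right {θ θ' : ℝ} (hθ : θ ∈ Ioo 0 (Real.pi / 2))
    (hθ' : θ' ∈ Ioo 0 (Real.pi / 2)) {o : ℂ → ℂ} (ho : IsOrientation o) (k l : ℤ) :
    (k = l + 1 → ∃ p : ℂ, MeetsOnceAt o k (Complex.exp (-(θ' * Complex.I)))
        l (Complex.exp (θ * Complex.I)) p (-1)) ∧
    (k = l → ∃ p : ℂ, MeetsOnceAt o k (Complex.exp (-(θ' * Complex.I)))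
        l (Complex.exp (θ * Complex.I)) p 1) ∧
    (k ≠ l → k ≠ l + 1 → L k (Complex.exp (-(θ' * Complex.I))) ∩
        L l (Complex.exp (θ * Complex.I)) = ∅) := by
  obtain ⟨o', γ, δ, h, hmeet⟩ := ho.exists_isCrossing (η := 1) (by norm_num) hθ hθ'
    isSheetPair_strips (by simp) (by simp : Complex.exp (-(θ' * Complex.I)) = _)
    (by simp : Complex.exp (θ * Complex.I) = _)
  refine ⟨?_, ?_, fun hkl hkl' => ?_⟩
  · rintro rfl
    have hne : l + 1 ≠ l := by omega
    obtain ⟨s, t, hs, ht, hW⟩ := h.exists_pos_W_eq (k := l + 1) (l := l) (by push_cast; linarith)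
    have h1 := add_crit_mem_stripSheet (h.param'.mem_of_neg _ (neg_lt_zero.2 hs)) (l + 1)
    have h2 := add_crit_mem_stripSheet (h.param.mem_of_pos _ ht) l
    rw [neg_add_cancel_comm_assoc] at h1
    rw [zero_add] at h2
    -- The lower branch at `Y_{l+1}` and the upper branch at `Y_l` share strip `l`.
    have heq : γ (-s) + crit (l + 1) = δ t + crit l :=
      injOn_stripSheet l h1 h2 (hW _ _ (neg_sq s) rfl)
    have hm := h.meetsOnceAt_of_eq rfl rfl hne heq fun s' t' hst => by
      obtain ⟨hs', ht'⟩ := h.ne_zero_of_eq hne hst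
      refine mul_pos_of_neg_of_neg (neg_lt_zero.2 hs) (lt_of_le_of_ne (not_lt.1 fun h0 => ?_) hs')
      have h1 := add_crit_mem_stripSheet (h.param'.mem_of_pos s' h0) (l + 1)
      rw [hst] at h1
      rcases lt_or_gt_of_ne ht' with h2 | h2
      · have := eq_of_mem_stripSheet h1 (add_crit_mem_stripSheet (h.param.mem_of_neg t' h2) l)
        omega
      · have := eq_of_mem_stripSheet h1 (add_crit_mem_stripSheet (h.param.mem_of_pos t' h2) l)
        omega
    rw [neg_mul, sign_neg (neg_lt_zero.2 (mul_pos hs ht))] at hm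
    exact ⟨_, hmeet _ _ _ _ hm⟩
  · rintro rfl
    exact ⟨_, hmeet _ _ _ _ (h.meetsOnceAt_self rfl rfl k)⟩
  · rw [eq_empty_iff_forall_notMem]
    rintro p hp
    obtain ⟨s, t, rfl, hst⟩ := h.mem_inter_iff.1 hp
    have h1 := h.nonneg_of_eq hst.symm
    have h2 : (l : ℝ) ≤ k := by linarith
    have h2 : l ≤ k := by exact_mod_cast h2
    obtain ⟨hs, ht⟩ := h.ne_zero_of_eq hkl hst.symm
    -- A common strip has index at least `k - 1` and at most `l`; with `l ≤ k` this leaves only `k =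
    -- l` and `k = l + 1`.
    have h3 : ∃ m : ℤ, -1 ≤ m ∧ γ s + crit k ∈ stripSheet (m + k) := by
      rcases lt_or_gt_of_ne hs with h3 | h3
      · exact ⟨-1, le_rfl, add_crit_mem_stripSheet (h.param'.mem_of_neg s h3) k⟩
      · exact ⟨0, by omega, add_crit_mem_stripSheet (h.param'.mem_of_pos s h3) k⟩
    have h4 : ∃ m : ℤ, m ≤ 0 ∧ δ t + crit l ∈ stripSheet (m + l) := by
      rcases lt_or_gt_of_ne ht with h3 | h3
      · exact ⟨-1, by omega, add_crit_mem_stripSheet (h.param.mem_of_neg t h3) l⟩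
      · exact ⟨0, le_rfl, add_crit_mem_stripSheet (h.param.mem_of_pos t h3) l⟩
    obtain ⟨m, hm, h3⟩ := h3
    obtain ⟨n, hn, h4⟩ := h4
    rw [hst] at h4
    have := eq_of_mem_stripSheet h3 h4
    omega

end Thimble

end

theorem lemma4p2 (θ θ' : ℝ) (hθ : θ ∈ Set.Ioo 0 (Real.pi / 2))
    (hθ' : θ' ∈ Set.Ioo 0 (Real.pi / 2)) (o : ℂ → ℂ) (ho : Thimble.IsOrientation o) (k l : ℤ) :
    -- the intersections `I_{k,l}`
    (k ≤ l → ∃ p : ℂ, Thimble.MeetsOnceAt o k (-Complex.exp (-(θ' * Complex.I)))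
        l (-Complex.exp (θ * Complex.I)) p 1) ∧
    (¬ k ≤ l → Thimble.L k (-Complex.exp (-(θ' * Complex.I))) ∩
        Thimble.L l (-Complex.exp (θ * Complex.I)) = ∅) ∧
    -- the intersections `J_{k,l}`
    (k = l + 1 → ∃ p : ℂ, Thimble.MeetsOnceAt o k (Complex.exp (-(θ' * Complex.I)))
        l (Complex.exp (θ * Complex.I)) p (-1)) ∧
    (k = l → ∃ p : ℂ, Thimble.MeetsOnceAt o k (Complex.exp (-(θ' * Complex.I)))
        l (Complex.exp (θ * Complex.I)) p 1) ∧
    (k ≠ l → k ≠ l + 1 → Thimble.L k (Complex.exp (-(θ' * Complex.I))) ∩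
        Thimble.L l (Complex.exp (θ * Complex.I)) = ∅) := by
  have h1 := Thimble.intersections_left hθ hθ' ho k l
  exact ⟨h1.1, h1.2, Thimble.intersections_right hθ hθ' ho k l⟩
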